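/- Let $k$ be a unital commutative ring and let $A$ be an involutive $k$-algebra: an associative unital $k$-algebra with an additive map $a\mapsto\overline a$ such that $\overline{ab}=\overline b\,\overline a$, $\overline{\overline a}=a$ and $\overline\lambda=\lambda$ for $\lambda\in k$. Write $[n]=\{0,\dots,n\}$, $n\ge 0$, and $C_2=\{1,t\}$. For a small category $\mathbf C$ and functors $G\colon\mathbf C^{op}\to\mathbf{Mod}_k$, $F\colon\mathbf C\to\mathbf{Mod}_k$, let $\mathrm{Tor}^{\mathbf C}_\star(G,F)$ be the left derived functors of the coend $G\otimes_{\mathbf C}F=\int^{C}G(C)\otimes_k F(C)$. Let $H_{n+1}=C_2^{n+1}\rtimes\Sigma_{n+1}$ be the hyperoctahedral group, of elements $g=(z_0,\dots,z_n;\sigma)$ with $\sigma$ a permutation of $[n]$ and $z_j$ the label of the source element $j$. Let $D_{n+1}\subset H_{n+1}$ be the dihedral subgroup generated by $T=(1,\dots,1;\,i\mapsto i+1 \bmod n+1)$ and $R=(t,\dots,t;\,i\mapsto n-i)$, and let $H_{n+1}^+\subset H_{n+1}$ be the subgroup of elements with $z_0=1$, $\sigma(0)=0$. Let $\Delta H$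 be the hyperoctahedral category: objects $[n]$, morphisms $[n]\to[m]$ the pairs $(\phi,g)=\phi\circ g$ with $\phi\colon[n]\to[m]$ order-preserving and $g\in H_{n+1}$, composed by means of the hyperoctahedral crossed simplicial group structure. Let $\Delta D\subset\Delta H$ be the dihedral category, of the pairs $(\phi,g)$ with $g\in D_{n+1}$. Let $\mathcal{IF}(as)$ be the category of involutive non-commutative sets: objects $[n]$, morphisms $f\colon[n]\to[m]$ the maps of sets with a total ordering and $C_2$-labels on each fibre $f^{-1}(i)$, and composition $(g\circ f)^{-1}(i)=\coprod_{j^\alpha\in g^{-1}(i)}\alpha * f^{-1}(j)$ (ordered disjoint union), where $t*$ reverses the order and multiplies every label by $t$. There is an isomorphism $\Delta H\cong\mathcal{IF}(as)$, the identity on objects, which sends $(\phi,(z;\sigma))$ to $\phi\sigma$, with fibres ordered by $\sigma$ and with labels $z_j$. Let $\mathcal L(A)\colon\Delta D^{op}\to\mathbf{Mod}_k$ be the Loday functor: $\mathcal L(A)([n])=A^{\otimes n+1}$, with faces $\partial_i(a_0\otimes\cdots\otimes a_n)=a_0\otimes\cdots\otimes a_ia_{i+1}\otimes\cdots\otimes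 a_n$ for $i<n$ and $\partial_n(a_0\otimes\cdots\otimes a_n)=a_na_0\otimes a_1\otimes\cdots\otimes a_{n-1}$, degeneracies $s_j$ inserting $1_A$ after $a_j$, and operators $t_{n+1}(a_0\otimes\cdots\otimes a_n)=a_n\otimes a_0\otimes\cdots\otimes a_{n-1}$ and $r_{n+1}(a_0\otimes\cdots\otimes a_n)=\overline{a_0}\otimes\overline{a_n}\otimes\cdots\otimes\overline{a_1}$, where $r_{n+1}$ is the action of $R$ and $t_{n+1}$ that of the automorphism $T^{-1}$ of $[n]$ in $\Delta D$. Let $k^*$ be the constant functor with value $k$, and let $$HD_\star(A)=\mathrm{Tor}^{\Delta D^{op}}_\star\bigl(k^*,\mathcal L(A)\bigr)$$ be the dihedral homology of $A$. Let $\mathsf H_A\colon\mathcal{IF}(as)\to\mathbf{Mod}_k$ be the hyperoctahedral bar construction: $\mathsf H_A([n])=A^{\otimes n+1}$ and $\mathsf H_A(f)(a_0\otimes\cdots\otimes a_n)=b_0\otimes\cdots\otimes b_m$ with $b_i=\prod_{j\in f^{-1}(i)}a_j^{z_j}$, the product being taken in the order of $f^{-1}(i)$, where $a^1=a$ and $a^t=\overline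 a$. Let $B\colon\mathcal{IF}(as)^{op}\to\mathbf{Mod}_k$ be the functor with $B([n])=k[H_{n+1}^+]$, on which $f\colon[n]\to[m]$ acts by pre-composition: it sends $h\in H_{m+1}^+$ to the element $h'\in H_{n+1}^+$ of the unique factorization $h\circ f=\delta\circ h'$ in $\mathcal{IF}(as)\cong\Delta H$ with $\delta\in\Delta D$ and $h'\in H_{n+1}^+$. Write also $\mathsf H_A$ and $B$ for the corresponding functors on $\Delta H$ and $\Delta H^{op}$, obtained through the isomorphism $\Delta H\cong\mathcal{IF}(as)$. Then there are isomorphisms of graded $k$-modules $$HD_\star(A)=\mathrm{Tor}^{\Delta D^{op}}_\star\bigl(k^*,\mathcal L(A)\bigr)\;\cong\;\mathrm{Tor}^{\mathcal{IF}(as)}_\star\bigl(B,\mathsf H_A\bigr)\;\cong\;\mathrm{Tor}^{\Delta H}_\star\bigl(B,\mathsf H_A\bigr).$$ -/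

import Mathlib

open CategoryTheory

universe u

namespace DihHom

/-! ## Functor homology: `G ⊗_C F` as a coend and its left derived functors -/

section FunctorHomology

variable (k : Type u) [CommRing k] (C : Type) [SmallCategory C]

/-- The functor category `Fun(C, Mod_k)` has enough projectives (sums of free modules on
representable functors). -/
instance enoughProjectives_functor : EnoughProjectives (C ⥤ ModuleCat.{u} k) where
  presentation F := by
    let P : C → (C ⥤ ModuleCat.{u} k) := fun c =>
      (evaluationLeftAdjoint (ModuleCat.{u} k) c).obj (Projective.over (F.obj c))
    let q : ∀ c, P c ⟶ F := fun c =>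
      ((evaluationAdjunctionRight (ModuleCat.{u} k) c).homEquiv _ _).symm (Projective.π (F.obj c))
    have hP : ∀ c, Projective (P c) := fun c =>
      (evaluationAdjunctionRight (ModuleCat.{u} k) c).map_projective _ inferInstance
    have hq : Epi (Limits.Sigma.desc q) := by
      have : ∀ c, Epi ((Limits.Sigma.desc q).app c) := by
        intro c
        have h : ((evaluationAdjunctionRight (ModuleCat.{u} k) c).homEquiv _ _)
            (Limits.Sigma.ι P c ≫ Limits.Sigma.desc q) = Projective.π (F.obj c) := by
          rw [Limits.Sigma.ι_desc]
          exact Equiv.apply_symm_apply _ _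
        rw [Adjunction.homEquiv_unit] at h
        refine @epi_of_epi_fac _ _ _ _ _
          ((evaluationAdjunctionRight (ModuleCat.{u} k) c).unit.app _ ≫ (Limits.Sigma.ι P c).app c)
          _ (Projective.π (F.obj c)) inferInstance ?_
        rw [Category.assoc]
        exact h
      exact NatTrans.epi_of_epi_app _
    have hS : Projective (∐ P) :=
      ⟨fun f e _ => ⟨Limits.Sigma.desc fun c =>
          @Projective.factorThru _ _ _ _ _ (hP c) (Limits.Sigma.ι P c ≫ f) e _, by
        apply Limits.Sigma.hom_ext
        intro c
        rw [Limits.Sigma.ι_desc_assoc]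
        exact @Projective.factorThru_comp _ _ _ _ _ (hP c) _ e _⟩⟩
    exact ⟨{ p := ∐ P, projective := hS, f := Limits.Sigma.desc q, epi := hq }⟩

variable {C}

/-- The bifunctor `(c, d) ↦ G(c) ⊗ F(d)`. -/
noncomputable abbrev tensorBifunctor (G : Cᵒᵖ ⥤ ModuleCat.{u} k) (F : C ⥤ ModuleCat.{u} k) :
    Cᵒᵖ ⥤ C ⥤ ModuleCat.{u} k :=
  (G ⋙ MonoidalCategory.curriedTensor (ModuleCat.{u} k)) ⋙
    (Functor.whiskeringLeft C (ModuleCat.{u} k) (ModuleCat.{u} k)).obj F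

/-- The map `G ⊗_C F ⟶ G ⊗_C F'` induced by `F ⟶ F'`. -/
noncomputable abbrev tensorMap (G : Cᵒᵖ ⥤ ModuleCat.{u} k) {F F' : C ⥤ ModuleCat.{u} k}
    (η : F ⟶ F') :
    Limits.coend (tensorBifunctor k G F) ⟶ Limits.coend (tensorBifunctor k G F') :=
  Limits.coend.map (F := tensorBifunctor k G F) (F' := tensorBifunctor k G F')
    (Functor.whiskerLeft (G ⋙ MonoidalCategory.curriedTensor (ModuleCat.{u} k))
      ((Functor.whiskeringLeft C (ModuleCat.{u} k) (ModuleCat.{u} k)).map η))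

theorem tensorMap_add (G : Cᵒᵖ ⥤ ModuleCat.{u} k) {F F' : C ⥤ ModuleCat.{u} k}
    (η θ : F ⟶ F') : tensorMap k G (η + θ) = tensorMap k G η + tensorMap k G θ := by
  apply Limits.coend.hom_ext
  intro c
  rw [Preadditive.comp_add]
  simp [MonoidalPreadditive.whiskerLeft_add]

/-- The tensor product over `C`, as a functor in the left module:
`F ↦ G ⊗_C F = ∫^c G(c) ⊗ F(c)`. -/
noncomputable def tensorOver (G : Cᵒᵖ ⥤ ModuleCat.{u} k) :
    (C ⥤ ModuleCat.{u} k) ⥤ ModuleCat.{u} k where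
  obj F := Limits.coend (tensorBifunctor k G F)
  map η := tensorMap k G η
  map_id F := by
    apply Limits.coend.hom_ext
    intro c
    simp
  map_comp η θ := by
    apply Limits.coend.hom_ext
    intro c
    simp

instance tensorOver_additive (G : Cᵒᵖ ⥤ ModuleCat.{u} k) : (tensorOver k G).Additive where
  map_add {_ _ η θ} := tensorMap_add k G η θ

/-- `Tor_⋆^C(G, F)`, as a graded `k`-module: the left derived functors of `G ⊗_C -`, at `F`. -/
noncomputable def Tor (G : Cᵒᵖ ⥤ ModuleCat.{u} k) (F : C ⥤ ModuleCat.{u} k) :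
    GradedObject ℕ (ModuleCat.{u} k) :=
  fun n => ((tensorOver k G).leftDerived n).obj F

/-- The `k`-constant functor. -/
noncomputable def constFunctor (C : Type) [SmallCategory C] : C ⥤ ModuleCat.{u} k :=
  (Functor.const C).obj (ModuleCat.of k k)

end FunctorHomology

/-! ## Labelled ordered sets and involutive non-commutative sets

The group `C₂` is `ℤˣ = {1, -1}`, with generator `t = -1`. A finite totally ordered `C₂`-set is
a duplicate-free list of pairs `(element, label)`. -/

section Lists

variable {X Y Z : Type}

/-- The action of `C₂` on totally ordered `C₂`-sets: `t` reverses the order and multiplies each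
label by `t`. -/
def twist (ε : ℤˣ) (l : List (X × ℤˣ)) : List (X × ℤˣ) :=
  if ε = 1 then l else (l.map fun p => (p.1, ε * p.2)).reverse

@[simp] theorem twist_one (l : List (X × ℤˣ)) : twist 1 l = l := by simp [twist]

theorem twist_neg_one (l : List (X × ℤˣ)) :
    twist (-1) l = (l.map fun p => (p.1, -p.2)).reverse := by
  simp [twist]

theorem twist_perm (ε : ℤˣ) (l : List (X × ℤˣ)) :
    ((twist ε l).map Prod.fst).Perm (l.map Prod.fst) := by
  rcases Int.units_eq_one_or ε with rfl | rfl
  · simp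
  · rw [twist_neg_one, List.map_reverse, List.map_map]
    exact List.reverse_perm _

theorem twist_twist (ε δ : ℤˣ) (l : List (X × ℤˣ)) :
    twist ε (twist δ l) = twist (ε * δ) l := by
  rcases Int.units_eq_one_or ε with rfl | rfl <;> rcases Int.units_eq_one_or δ with rfl | rfl <;>
    simp [twist_neg_one, Function.comp_def]

/-- `famComp F G i` is the ordered disjoint union `∐_{j^α ∈ G i} α * F j`. -/
def famComp (F : Y → List (X × ℤˣ)) (G : Z → List (Y × ℤˣ)) (i : Z) : List (X × ℤˣ) :=
  (G i).flatMap fun p => twist p.2 (F p.1)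

theorem twist_flatMap (ε : ℤˣ) (F : Y → List (X × ℤˣ)) (l : List (Y × ℤˣ)) :
    twist ε (l.flatMap fun p => twist p.2 (F p.1)) =
      (twist ε l).flatMap fun p => twist p.2 (F p.1) := by
  rcases Int.units_eq_one_or ε with rfl | rfl
  · simp
  · rw [twist_neg_one, twist_neg_one, List.map_flatMap, List.reverse_flatMap,
      ← List.map_reverse, List.flatMap_map]
    congr 1
    funext p
    have h : twist (-p.2) (F p.1) = twist (-1) (twist p.2 (F p.1)) := by
      rw [twist_twist, neg_one_mul]
    simp only [h, Function.comp_apply, twist_neg_one]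

theorem famComp_assoc {W : Type} (F : Y → List (X × ℤˣ)) (G : Z → List (Y × ℤˣ))
    (H : W → List (Z × ℤˣ)) : famComp F (famComp G H) = famComp (famComp F G) H := by
  funext i
  simp only [famComp, List.flatMap_assoc, twist_flatMap]

/-- The family of one-element lists `{j^1}`. -/
def famId (X : Type) (i : X) : List (X × ℤˣ) := [(i, 1)]

@[simp] theorem famComp_famId (F : Y → List (X × ℤˣ)) : famComp F (famId Y) = F := by
  funext i; simp [famComp, famId]

@[simp] theorem famId_famComp (F : Y → List (X × ℤˣ)) : famComp (famId X) F = F := by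
  funext i
  have : (fun p : X × ℤˣ => twist p.2 (famId X p.1)) = fun p => [p] := by
    funext p
    rcases p with ⟨x, ε⟩
    rcases Int.units_eq_one_or ε with rfl | rfl <;> simp [famId, twist_neg_one]
  rw [famComp, this]
  simp

/-- A family of labelled lists in which every element of `X` occurs exactly once. -/
def IsShuffle (F : Y → List (X × ℤˣ)) : Prop :=
  (∀ i, ((F i).map Prod.fst).Nodup) ∧ ∀ j, ∃! i, j ∈ (F i).map Prod.fst

theorem mem_famComp (F : Y → List (X × ℤˣ)) (G : Z → List (Y × ℤˣ)) (i : Z) (x : X) :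
    x ∈ (famComp F G i).map Prod.fst ↔
      ∃ y, y ∈ (G i).map Prod.fst ∧ x ∈ (F y).map Prod.fst := by
  simp only [famComp, List.map_flatMap, List.mem_flatMap, (twist_perm _ _).mem_iff]
  constructor
  · rintro ⟨p, hp, h⟩
    exact ⟨p.1, List.mem_map_of_mem hp, h⟩
  · rintro ⟨y, hy, h⟩
    obtain ⟨p, hp, rfl⟩ := List.mem_map.1 hy
    exact ⟨p, hp, h⟩

theorem IsShuffle.comp {F : Y → List (X × ℤˣ)} {G : Z → List (Y × ℤˣ)}
    (hF : IsShuffle F) (hG : IsShuffle G) : IsShuffle (famComp F G) := by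
  refine ⟨fun i => ?_, fun x => ?_⟩
  · rw [famComp, List.map_flatMap, List.nodup_flatMap]
    refine ⟨fun p _ => (twist_perm _ _).nodup_iff.2 (hF.1 p.1), ?_⟩
    have h := hG.1 i
    rw [List.Nodup, List.pairwise_map] at h
    refine h.imp fun {p q} hpq x hx hx' => hpq ?_
    rw [(twist_perm _ _).mem_iff] at hx hx'
    exact (hF.2 x).unique hx hx'
  · obtain ⟨y, hy, huy⟩ := hF.2 x
    obtain ⟨i, hi, hui⟩ := hG.2 y
    refine ⟨i, (mem_famComp F G i x).2 ⟨y, hi, hy⟩, fun i' hi' => ?_⟩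
    obtain ⟨y', hy', hxy'⟩ := (mem_famComp F G i' x).1 hi'
    exact hui i' (huy y' hxy' ▸ hy')

end Lists

/-- A morphism `[n] → [m]` of involutive non-commutative sets: a map of finite sets together with
a total ordering and `C₂`-labels on each fibre. -/
@[ext]
structure IFHom (n m : ℕ) where
  /-- the underlying map -/
  toFun : Fin (n + 1) → Fin (m + 1)
  /-- the ordered, labelled fibres -/
  fib : Fin (m + 1) → List (Fin (n + 1) × ℤˣ)
  nodup_fib : ∀ i, ((fib i).map Prod.fst).Nodup
  mem_fib : ∀ i j, j ∈ (fib i).map Prod.fst ↔ toFun j = i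

namespace IFHom

variable {n m l : ℕ}

theorem isShuffle (f : IFHom n m) : IsShuffle f.fib :=
  ⟨f.nodup_fib, fun j => ⟨f.toFun j, (f.mem_fib _ _).2 rfl, fun i hi => ((f.mem_fib i j).1 hi).symm⟩⟩

theorem ext_fib {f g : IFHom n m} (h : f.fib = g.fib) : f = g := by
  refine IFHom.ext (funext fun j => ?_) h
  have : j ∈ (g.fib (f.toFun j)).map Prod.fst := h ▸ (f.mem_fib _ _).2 rfl
  exact ((g.mem_fib _ _).1 this).symm

/-- The identity. -/
def id (n : ℕ) : IFHom n n where
  toFun j := j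
  fib := famId _
  nodup_fib i := by simp [famId]
  mem_fib i j := by simp [famId]

/-- The composite `g ∘ f`, with `(g ∘ f)⁻¹(i) = ∐_{j^α ∈ g⁻¹(i)} α * f⁻¹(j)`. -/
def comp (f : IFHom n m) (g : IFHom m l) : IFHom n l where
  toFun j := g.toFun (f.toFun j)
  fib := famComp f.fib g.fib
  nodup_fib := (f.isShuffle.comp g.isShuffle).1
  mem_fib i j := by
    rw [mem_famComp]
    simp only [mem_fib]
    constructor
    · rintro ⟨y, rfl, rfl⟩; rfl
    · rintro h; exact ⟨_, h, rfl⟩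

end IFHom

/-- The category `IF(as)` of involutive non-commutative sets; `⟨n⟩` is the object `[n]`. -/
@[ext]
structure IFas where
  /-- the number `n` of the object `[n]` -/
  deg : ℕ

instance : SmallCategory IFas where
  Hom a b := IFHom a.deg b.deg
  id a := IFHom.id a.deg
  comp f g := f.comp g
  id_comp f := IFHom.ext_fib (famId_famComp f.fib)
  comp_id f := IFHom.ext_fib (famComp_famId f.fib)
  assoc f g h := IFHom.ext_fib (famComp_assoc f.fib g.fib h.fib).symm

/-! ## The hyperoctahedral groups and the category `ΔH` -/

theorem perm_apply_inv {X : Type} (σ : Equiv.Perm X) (j : X) : σ (σ⁻¹ j) = j :=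
  σ.apply_symm_apply j

theorem perm_eq_of_lt {n : ℕ} {σ τ : Equiv.Perm (Fin n)} (h : ∀ i j, σ i < σ j → τ i < τ j) :
    σ = τ := by
  have hm : Monotone (τ * σ⁻¹) :=
    StrictMono.monotone fun a b hab => h _ _ (by simpa using hab)
  exact (mul_inv_eq_one.1 ((Equiv.Perm.monotone_iff _).1 hm)).symm

/-- The hyperoctahedral group `H_{n+1}`: elements `(z₀, …, z_n; σ)` with `z_j ∈ C₂` and `σ` a
permutation of `[n]`. The label `z_j` belongs to the element `j` of the source, so that
`(z; σ)` is the signed permutation `j ↦ σ(j)^{z_j}`. -/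
@[ext]
structure Hyp (n : ℕ) where
  /-- the labels -/
  lab : Fin (n + 1) → ℤˣ
  /-- the permutation -/
  perm : Equiv.Perm (Fin (n + 1))

namespace Hyp

variable {n m l : ℕ}

instance : Mul (Hyp n) := ⟨fun g h => ⟨fun j => g.lab (h.perm j) * h.lab j, g.perm * h.perm⟩⟩
instance : One (Hyp n) := ⟨⟨fun _ => 1, 1⟩⟩
instance : Inv (Hyp n) := ⟨fun g => ⟨fun j => (g.lab (g.perm⁻¹ j))⁻¹, g.perm⁻¹⟩⟩

@[simp] theorem mul_lab (g h : Hyp n) (j) : (g * h).lab j = g.lab (h.perm j) * h.lab j := rfl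
@[simp] theorem mul_perm (g h : Hyp n) : (g * h).perm = g.perm * h.perm := rfl
@[simp] theorem one_lab (j) : (1 : Hyp n).lab j = 1 := rfl
@[simp] theorem one_perm : (1 : Hyp n).perm = 1 := rfl
@[simp] theorem inv_lab (g : Hyp n) (j) : (g⁻¹).lab j = (g.lab (g.perm⁻¹ j))⁻¹ := rfl
@[simp] theorem inv_perm (g : Hyp n) : (g⁻¹).perm = g.perm⁻¹ := rfl

instance : Group (Hyp n) :=
  Group.ofLeftAxioms
    (fun a b c => by ext <;> simp [mul_assoc])
    (fun a => by ext <;> simp)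
    (fun a => by ext <;> simp)

/-- The element `T = (1, …, 1; t_{n+1})`, with `t_{n+1}(i) = i + 1` cyclically. -/
def T (n : ℕ) : Hyp n := ⟨fun _ => 1, Equiv.addRight 1⟩

/-- The element `R = (t, …, t; r_{n+1})`, with `r_{n+1}(i) = n - i`. -/
def R (n : ℕ) : Hyp n := ⟨fun _ => -1, Fin.revPerm⟩

/-- The dihedral group `D_{n+1}`, as the subgroup of `H_{n+1}` generated by `R` and `T`. -/
def dihedral (n : ℕ) : Subgroup (Hyp n) := Subgroup.closure {R n, T n}

/-- The subgroup `H_{n+1}^+` of the elements with `z_0 = 1` and `σ(0) = 0`. -/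
def plus (n : ℕ) : Subgroup (Hyp n) where
  carrier := {g | g.lab 0 = 1 ∧ g.perm 0 = 0}
  mul_mem' := by rintro a b ⟨ha, ha'⟩ ⟨hb, hb'⟩; simp [ha, ha', hb, hb']
  one_mem' := by simp
  inv_mem' := by
    rintro a ⟨ha, ha'⟩
    have : a.perm⁻¹ 0 = 0 := by rw [Equiv.Perm.inv_eq_iff_eq, ha']
    simp [this, ha]

/-- For `g = (z; σ) ∈ H_{m+1}` and `φ : [n] → [m]`, the composite `g ∘ φ` orders `[n]` by the
position `σ(φ(p))` of the block of `p` first; inside a block the order is kept if the block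
has label `1` and reversed if it has label `t`. -/
def key (g : Hyp m) (φ : Fin (n + 1) →o Fin (m + 1)) (p : Fin (n + 1)) :
    Fin (m + 1) ×ₗ ℤ :=
  toLex (g.perm (φ p), (g.lab (φ p) : ℤ) * (p : ℕ))

/-- The crossed simplicial structure: `φ^*(g) ∈ H_{n+1}` in `g ∘ φ = g_*(φ) ∘ φ^*(g)`. -/
def pull (g : Hyp m) (φ : Fin (n + 1) →o Fin (m + 1)) : Hyp n :=
  ⟨fun p => g.lab (φ p), (Tuple.sort (g.key φ))⁻¹⟩

theorem key_fst_mono {g : Hyp m} {φ : Fin (n + 1) →o Fin (m + 1)} {p q : Fin (n + 1)}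
    (h : g.key φ p ≤ g.key φ q) : g.perm (φ p) ≤ g.perm (φ q) := by
  rcases Prod.Lex.le_iff.1 h with h | h
  · exact le_of_lt h
  · exact le_of_eq h.1

/-- The crossed simplicial structure: the order-preserving map `g_*(φ)` in
`g ∘ φ = g_*(φ) ∘ φ^*(g)`. -/
def push (g : Hyp m) (φ : Fin (n + 1) →o Fin (m + 1)) : Fin (n + 1) →o Fin (m + 1) where
  toFun p := g.perm (φ ((g.pull φ).perm⁻¹ p))
  monotone' p q h := key_fst_mono (by simpa [pull] using Tuple.monotone_sort (g.key φ) h)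

@[simp] theorem pull_lab (g : Hyp m) (φ : Fin (n + 1) →o Fin (m + 1)) (p) :
    (g.pull φ).lab p = g.lab (φ p) := rfl

@[simp] theorem push_pull (g : Hyp m) (φ : Fin (n + 1) →o Fin (m + 1)) (p) :
    g.push φ ((g.pull φ).perm p) = g.perm (φ p) := by
  simp [push]

theorem key_injective (g : Hyp m) (φ : Fin (n + 1) →o Fin (m + 1)) :
    Function.Injective (g.key φ) := by
  intro p q h
  have h1 := congrArg (fun x => (ofLex x).1) h
  have h2 := congrArg (fun x => (ofLex x).2) h
  simp only [key, ofLex_toLex, EmbeddingLike.apply_eq_iff_eq] at h1 h2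
  rw [h1] at h2
  have h3 := mul_left_cancel₀ (Units.ne_zero (g.lab (φ q))) h2
  exact Fin.ext (by exact_mod_cast h3)

theorem pull_lt_iff_key (g : Hyp m) (φ : Fin (n + 1) →o Fin (m + 1)) (p q) :
    (g.pull φ).perm p < (g.pull φ).perm q ↔ g.key φ p < g.key φ q := by
  have hs : StrictMono (g.key φ ∘ Tuple.sort (g.key φ)) :=
    (Tuple.monotone_sort _).strictMono_of_injective
      ((g.key_injective φ).comp (Tuple.sort _).injective)
  rw [← hs.lt_iff_lt]
  simp [pull]

theorem pull_lt_iff (g : Hyp m) (φ : Fin (n + 1) →o Fin (m + 1)) (p q) :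
    (g.pull φ).perm p < (g.pull φ).perm q ↔
      g.perm (φ p) < g.perm (φ q) ∨
        φ p = φ q ∧ (g.lab (φ q) = 1 ∧ p < q ∨ g.lab (φ q) = -1 ∧ q < p) := by
  rw [pull_lt_iff_key, key, key, Prod.Lex.toLex_lt_toLex]
  simp only [EmbeddingLike.apply_eq_iff_eq]
  refine or_congr Iff.rfl (and_congr_right fun h => ?_)
  rw [h]
  rcases Int.units_eq_one_or (g.lab (φ q)) with e | e <;> rw [e] <;> simp

end Hyp

/-- A morphism `[n] → [m]` of `ΔH`: a pair `(φ, g)` with `φ : [n] → [m]` order-preserving and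
`g ∈ H_{n+1}`, to be thought of as `φ ∘ g`. -/
@[ext]
structure DHHom (n m : ℕ) where
  /-- the order-preserving map -/
  ord : Fin (n + 1) →o Fin (m + 1)
  /-- the group element -/
  grp : Hyp n

namespace DHHom

variable {n m l : ℕ}

/-- The identity. -/
def id (n : ℕ) : DHHom n n := ⟨OrderHom.id, 1⟩

/-- The composite `(ψ, h) ∘ (φ, g) = (ψ ∘ h_*(φ), φ^*(h) g)`. -/
def comp (x : DHHom n m) (y : DHHom m l) : DHHom n l :=
  ⟨y.ord.comp (y.grp.push x.ord), y.grp.pull x.ord * x.grp⟩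

/-- The underlying map of sets `φ ∘ σ`. -/
def toFun (x : DHHom n m) (j : Fin (n + 1)) : Fin (m + 1) := x.ord (x.grp.perm j)

theorem comp_toFun (x : DHHom n m) (y : DHHom m l) (j) :
    (x.comp y).toFun j = y.toFun (x.toFun j) := by
  simp [toFun, comp]

theorem comp_lab (x : DHHom n m) (y : DHHom m l) (j) :
    (x.comp y).grp.lab j = y.grp.lab (x.toFun j) * x.grp.lab j := by
  simp [toFun, comp]

theorem comp_lt (x : DHHom n m) (y : DHHom m l) (i j) :
    (x.comp y).grp.perm i < (x.comp y).grp.perm j ↔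
      y.grp.perm (x.toFun i) < y.grp.perm (x.toFun j) ∨
        x.toFun i = x.toFun j ∧ (y.grp.lab (x.toFun j) = 1 ∧ x.grp.perm i < x.grp.perm j ∨
          y.grp.lab (x.toFun j) = -1 ∧ x.grp.perm j < x.grp.perm i) := by
  simp [comp, toFun, Hyp.pull_lt_iff]

theorem lt_of_toFun_lt (x : DHHom n m) {i j} (h : x.toFun i < x.toFun j) :
    x.grp.perm i < x.grp.perm j := by
  by_contra hc
  exact absurd (x.ord.monotone (not_lt.1 hc)) (not_le.2 h)

/-- A morphism is determined by its underlying map, its labels, and the orders on fibres. -/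
theorem ext_of {x y : DHHom n m} (h1 : ∀ j, x.toFun j = y.toFun j)
    (h2 : ∀ j, x.grp.lab j = y.grp.lab j)
    (h3 : ∀ i j, x.toFun i = x.toFun j → x.grp.perm i < x.grp.perm j →
      y.grp.perm i < y.grp.perm j) : x = y := by
  have key : ∀ i j, x.grp.perm i < x.grp.perm j → y.grp.perm i < y.grp.perm j := by
    intro i j h
    have hle : x.toFun i ≤ x.toFun j := x.ord.monotone h.le
    rcases hle.lt_or_eq with h' | h'
    · exact y.lt_of_toFun_lt (by rw [← h1, ← h1]; exact h')
    · exact h3 i j h' h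
  have hperm : x.grp.perm = y.grp.perm := perm_eq_of_lt key
  refine DHHom.ext (OrderHom.ext _ _ (funext fun p => ?_)) (Hyp.ext (funext h2) hperm)
  have := h1 (x.grp.perm⁻¹ p)
  simpa [toFun, ← hperm] using this

theorem id_comp (x : DHHom n m) : (id n).comp x = x := by
  refine ext_of (fun j => ?_) (fun j => ?_) (fun i j h1 h2 => ?_)
  · simp [comp_toFun]; rfl
  · rw [comp_lab]; simp [id, toFun]
  · rw [comp_lt] at h2
    simp [id, toFun] at h2
    rcases h2 with h2 | ⟨rfl, h2 | h2⟩
    · exact h2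
    · exact absurd h2.2 (lt_irrefl _)
    · exact absurd h2.2 (lt_irrefl _)

theorem comp_id (x : DHHom n m) : x.comp (id m) = x := by
  refine ext_of (fun j => ?_) (fun j => ?_) (fun i j h1 h2 => ?_)
  · simp [comp_toFun]; rfl
  · rw [comp_lab]; simp [id]
  · rw [comp_lt] at h2
    rw [comp_toFun, comp_toFun] at h1
    simp only [id, toFun, Hyp.one_perm, Hyp.one_lab, Equiv.Perm.one_apply, OrderHom.id_coe,
      _root_.id] at h1 h2
    rcases h2 with h2 | ⟨_, h2 | h2⟩
    · exact absurd h1 h2.ne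
    · exact h2.2
    · exact absurd h2.1 (by decide)

/-- The labelled, ordered fibre over `i`: the elements `j` with `φ(σ(j)) = i`, in the order
of `σ(j)`, with labels `z_j`. -/
def fib (x : DHHom n m) (i : Fin (m + 1)) : List (Fin (n + 1) × ℤˣ) :=
  ((List.finRange (n + 1)).filter fun p => x.ord p = i).map fun p =>
    (x.grp.perm⁻¹ p, x.grp.lab (x.grp.perm⁻¹ p))

theorem mem_fib_pair (x : DHHom n m) (i : Fin (m + 1)) (q : Fin (n + 1) × ℤˣ) :
    q ∈ x.fib i ↔ x.toFun q.1 = i ∧ x.grp.lab q.1 = q.2 := by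
  simp only [fib, List.mem_map, List.mem_filter, List.mem_finRange, true_and, decide_eq_true_eq]
  constructor
  · rintro ⟨p, hp, rfl⟩
    simp [toFun, hp]
  · rintro ⟨h, h'⟩
    exact ⟨x.grp.perm q.1, h, by simp [h']⟩

theorem pairwise_fib (x : DHHom n m) (i : Fin (m + 1)) :
    (x.fib i).Pairwise fun a b => x.grp.perm a.1 < x.grp.perm b.1 := by
  rw [fib, List.pairwise_map]
  simp only [perm_apply_inv]
  exact (List.pairwise_lt_finRange _).filter _

/-- The fibre list is determined by its elements and its order. -/
theorem eq_fib (x : DHHom n m) (i : Fin (m + 1)) (L : List (Fin (n + 1) × ℤˣ))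
    (h1 : ∀ q, q ∈ L ↔ x.toFun q.1 = i ∧ x.grp.lab q.1 = q.2)
    (h2 : L.Pairwise fun a b => x.grp.perm a.1 < x.grp.perm b.1) : L = x.fib i := by
  have hnd : ∀ {L : List (Fin (n + 1) × ℤˣ)},
      (L.Pairwise fun a b => x.grp.perm a.1 < x.grp.perm b.1) → L.Nodup := fun h =>
    h.imp fun hab e => absurd hab (by rw [e]; exact lt_irrefl _)
  refine List.Perm.eq_of_pairwise (fun a b _ _ hab hba => absurd hab (lt_asymm hba)) h2
    (x.pairwise_fib i) ?_
  rw [List.perm_ext_iff_of_nodup (hnd h2) (hnd (x.pairwise_fib i))]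
  exact fun q => by rw [h1, mem_fib_pair]

/-- The morphism of involutive non-commutative sets given by `(φ, g)`. -/
def toIF (x : DHHom n m) : IFHom n m where
  toFun := x.toFun
  fib := x.fib
  nodup_fib i := by
    rw [List.Nodup, List.pairwise_map]
    exact (x.pairwise_fib i).imp fun hab e => absurd hab (by rw [e]; exact lt_irrefl _)
  mem_fib i j := by
    simp [mem_fib_pair]

theorem toIF_id (n : ℕ) : (id n).toIF = IFHom.id n := by
  refine IFHom.ext_fib (funext fun i => ((id n).eq_fib i _ (fun q => ?_) ?_).symm)
  · rcases q with ⟨a, b⟩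
    simp [IFHom.id, famId, id, toFun, eq_comm]
  · simp [IFHom.id, famId]

theorem toIF_comp (x : DHHom n m) (y : DHHom m l) :
    (x.comp y).toIF = x.toIF.comp y.toIF := by
  refine IFHom.ext_fib (funext fun i => ((x.comp y).eq_fib i _ (fun q => ?_) ?_).symm)
  · simp only [IFHom.comp, famComp, toIF, List.mem_flatMap, mem_fib_pair, comp_toFun, comp_lab]
    have hm : ∀ (p : Fin (m + 1) × ℤˣ), q ∈ twist p.2 (x.fib p.1) ↔
        x.toFun q.1 = p.1 ∧ p.2 * x.grp.lab q.1 = q.2 := by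
      rintro ⟨p, ε⟩
      rcases Int.units_eq_one_or ε with rfl | rfl
      · simp [mem_fib_pair]
      · simp only [twist_neg_one, List.mem_reverse, List.mem_map, mem_fib_pair]
        constructor
        · rintro ⟨a, ⟨h, h'⟩, rfl⟩; simp [h, h']
        · rintro ⟨h, h'⟩
          exact ⟨(q.1, x.grp.lab q.1), ⟨h, rfl⟩, by rw [← neg_one_mul, h']⟩
    simp only [hm]
    constructor
    · rintro ⟨p, ⟨h1, h2⟩, h3, h4⟩
      rw [h3, h2]; exact ⟨h1, h4⟩
    · rintro ⟨h1, h2⟩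
      exact ⟨(x.toFun q.1, y.grp.lab (x.toFun q.1)), ⟨h1, rfl⟩, rfl, h2⟩
  · simp only [IFHom.comp, famComp, toIF]
    have hmem : ∀ (p : Fin (m + 1) × ℤˣ) q, q ∈ twist p.2 (x.fib p.1) → x.toFun q.1 = p.1 := by
      intro p q hq
      have : q.1 ∈ (twist p.2 (x.fib p.1)).map Prod.fst := List.mem_map_of_mem hq
      rw [(twist_perm _ _).mem_iff] at this
      obtain ⟨r, hr, hr'⟩ := List.mem_map.1 this
      rw [← hr']
      exact ((x.mem_fib_pair _ _).1 hr).1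
    rw [List.pairwise_flatMap]
    refine ⟨fun p hp => ?_, ?_⟩
    · have hlab := ((y.mem_fib_pair _ _).1 hp).2
      rcases p with ⟨p, ε⟩
      have hx := x.pairwise_fib p
      have hf : ∀ a ∈ x.fib p, x.toFun a.1 = p := fun a ha => ((x.mem_fib_pair _ _).1 ha).1
      rcases Int.units_eq_one_or ε with rfl | rfl
      · simp only [twist_one]
        refine hx.imp_of_mem fun {a b} ha hb hab => ?_
        rw [comp_lt, hf a ha, hf b hb]
        exact Or.inr ⟨rfl, Or.inl ⟨hlab, hab⟩⟩
      · simp only [twist_neg_one]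
        rw [List.pairwise_reverse, List.pairwise_map]
        refine hx.imp_of_mem fun {a b} ha hb hab => ?_
        rw [comp_lt, hf a ha, hf b hb]
        exact Or.inr ⟨rfl, Or.inr ⟨hlab, hab⟩⟩
    · refine (y.pairwise_fib i).imp fun {p q} hpq a ha b hb => ?_
      rw [comp_lt, hmem p a ha, hmem q b hb]
      exact Or.inl hpq

theorem toIF_injective : Function.Injective (toIF : DHHom n m → IFHom n m) := by
  intro x y h
  have hfib : ∀ i, x.fib i = y.fib i := fun i => congrFun (congrArg IFHom.fib h) i
  have hfun : ∀ j, x.toFun j = y.toFun j := fun j => congrFun (congrArg IFHom.toFun h) j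
  refine ext_of hfun (fun j => ?_) (fun i j hij hlt => ?_)
  · have : (j, x.grp.lab j) ∈ y.fib (x.toFun j) := by
      rw [← hfib, mem_fib_pair]; exact ⟨rfl, rfl⟩
    exact ((y.mem_fib_pair _ _).1 this).2.symm
  · by_contra hc
    have hi : (i, x.grp.lab i) ∈ x.fib (x.toFun i) := by rw [mem_fib_pair]; exact ⟨rfl, rfl⟩
    have hj : (j, x.grp.lab j) ∈ x.fib (x.toFun i) := by rw [mem_fib_pair]; exact ⟨hij.symm, rfl⟩
    have hne : i ≠ j := fun e => absurd hlt (by rw [e]; exact lt_irrefl _)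
    have hlt' : y.grp.perm j < y.grp.perm i :=
      lt_of_le_of_ne (not_lt.1 hc) fun e => hne (y.grp.perm.injective e).symm
    have hp : (x.fib (x.toFun i)).Pairwise fun a b =>
        x.grp.perm a.1 < x.grp.perm b.1 ∧ y.grp.perm a.1 < y.grp.perm b.1 :=
      (x.pairwise_fib _).and (by rw [hfib]; exact y.pairwise_fib _)
    have hp' := hp.imp (S := fun a b : Fin (n + 1) × ℤˣ =>
      ¬ (x.grp.perm a.1 < x.grp.perm b.1 ∧ y.grp.perm b.1 < y.grp.perm a.1) ∧
      ¬ (x.grp.perm b.1 < x.grp.perm a.1 ∧ y.grp.perm a.1 < y.grp.perm b.1))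
      fun {a b} hab => ⟨fun h => lt_asymm hab.2 h.2, fun h => lt_asymm hab.1 h.1⟩
    have : Std.Symm fun a b : Fin (n + 1) × ℤˣ =>
      ¬ (x.grp.perm a.1 < x.grp.perm b.1 ∧ y.grp.perm b.1 < y.grp.perm a.1) ∧
      ¬ (x.grp.perm b.1 < x.grp.perm a.1 ∧ y.grp.perm a.1 < y.grp.perm b.1) :=
      ⟨fun a b h => ⟨h.2, h.1⟩⟩
    have hs := List.Pairwise.forall_of_forall
      (fun a _ => ⟨fun h => lt_irrefl _ h.1, fun h => lt_irrefl _ h.1⟩) hp'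
    exact (hs hi hj).1 ⟨hlt, hlt'⟩

theorem comp_assoc {r : ℕ} (x : DHHom n m) (y : DHHom m l) (z : DHHom l r) :
    (x.comp y).comp z = x.comp (y.comp z) := by
  apply toIF_injective
  simp only [toIF_comp]
  exact IFHom.ext_fib (famComp_assoc _ _ _).symm

end DHHom

/-- The hyperoctahedral category `ΔH`; `⟨n⟩` is the object `[n]`. -/
@[ext]
structure DeltaH where
  /-- the number `n` of the object `[n]` -/
  deg : ℕ

instance : SmallCategory DeltaH where
  Hom a b := DHHom a.deg b.deg
  id a := DHHom.id a.deg
  comp f g := f.comp g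
  id_comp f := f.id_comp
  comp_id f := f.comp_id
  assoc f g h := f.comp_assoc g h

/-- The functor `ΔH → IF(as)` (an isomorphism of categories), the identity on objects. -/
def deltaHToIF : DeltaH ⥤ IFas where
  obj a := ⟨a.deg⟩
  map x := DHHom.toIF x
  map_id a := DHHom.toIF_id a.deg
  map_comp x y := DHHom.toIF_comp x y

/-! ## The dihedral category `ΔD ⊂ ΔH` -/

section Dihedral

variable {n m l : ℕ}

theorem unit_smul_smul (ε : ℤˣ) (j : Fin (n + 1)) : (ε : ℤ) • (ε : ℤ) • j = j := by
  rw [smul_smul, ← Units.val_mul, Int.units_mul_self, Units.val_one, one_smul]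

/-- The signed permutation `j ↦ k + ε j` (modulo `n + 1`), with all labels equal to `ε`. -/
def dihElt (ε : ℤˣ) (k : Fin (n + 1)) : Hyp n where
  lab _ := ε
  perm :=
    { toFun := fun j => k + (ε : ℤ) • j
      invFun := fun j => (ε : ℤ) • (j - k)
      left_inv := fun j => by dsimp only; rw [add_sub_cancel_left, unit_smul_smul]
      right_inv := fun j => by dsimp only; rw [unit_smul_smul, add_sub_cancel] }

@[simp] theorem dihElt_lab (ε : ℤˣ) (k j : Fin (n + 1)) : (dihElt ε k).lab j = ε := rfl

@[simp] theorem dihElt_perm (ε : ℤˣ) (k j : Fin (n + 1)) :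
    (dihElt ε k).perm j = k + (ε : ℤ) • j := rfl

theorem dihElt_mul (ε δ : ℤˣ) (k j : Fin (n + 1)) :
    dihElt ε k * dihElt δ j = dihElt (ε * δ) (k + (ε : ℤ) • j) := by
  refine Hyp.ext rfl (Equiv.ext fun i => ?_)
  simp [mul_smul, add_assoc]

theorem dihElt_one : dihElt 1 (0 : Fin (n + 1)) = 1 := by
  refine Hyp.ext rfl (Equiv.ext fun i => ?_)
  simp

theorem T_eq : Hyp.T n = dihElt 1 1 := by
  refine Hyp.ext rfl (Equiv.ext fun i => ?_)
  simp [Hyp.T, add_comm]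

theorem rev_eq (i : Fin (n + 1)) : i.rev = -1 - i := by
  have : (-1 : Fin (n + 1)) = Fin.last n := by
    exact neg_eq_of_add_eq_zero_left (Fin.last_add_one n)
  rw [this, Fin.last_sub]

theorem R_eq : Hyp.R n = dihElt (-1) (-1) := by
  refine Hyp.ext rfl (Equiv.ext fun i => ?_)
  simp [Hyp.R, rev_eq, sub_eq_add_neg]

theorem mem_dihedral (g : Hyp n) : g ∈ Hyp.dihedral n ↔ ∃ ε k, g = dihElt ε k := by
  constructor
  · intro h
    induction h using Subgroup.closure_induction with
    | mem x hx =>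
      rcases hx with rfl | rfl
      · exact ⟨_, _, R_eq⟩
      · exact ⟨_, _, T_eq⟩
    | one => exact ⟨_, _, dihElt_one.symm⟩
    | mul x y _ _ hx hy =>
      obtain ⟨ε, k, rfl⟩ := hx
      obtain ⟨δ, j, rfl⟩ := hy
      exact ⟨_, _, dihElt_mul _ _ _ _⟩
    | inv x _ hx =>
      obtain ⟨ε, k, rfl⟩ := hx
      refine ⟨ε, (ε : ℤ) • (-k), ?_⟩
      rw [inv_eq_iff_mul_eq_one, dihElt_mul, unit_smul_smul, add_neg_cancel, Int.units_mul_self,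
        dihElt_one]
  · rintro ⟨ε, k, rfl⟩
    have hT : Hyp.T n ∈ Hyp.dihedral n := Subgroup.subset_closure (by simp)
    have hR : Hyp.R n ∈ Hyp.dihedral n := Subgroup.subset_closure (by simp)
    have hpow : ∀ s : ℕ, dihElt 1 (s • (1 : Fin (n + 1))) ∈ Hyp.dihedral n := by
      intro s
      induction s with
      | zero => rw [zero_smul, dihElt_one]; exact one_mem _
      | succ s ih =>
        have := mul_mem ih hT
        rwa [T_eq, dihElt_mul, Units.val_one, one_smul, mul_one, ← succ_nsmul] at this
    have hall : ∀ j : Fin (n + 1), dihElt 1 j ∈ Hyp.dihedral n := by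
      intro j
      have hj : j.val • (1 : Fin (n + 1)) = j := by
        refine Fin.induction ?_ (fun i hi => ?_) j
        · simp
        · rw [Fin.val_succ, succ_nsmul, ← Fin.coeSucc_eq_succ]
          rw [Fin.val_castSucc] at hi
          rw [hi]
      rw [← hj]; exact hpow _
    rcases Int.units_eq_one_or ε with rfl | rfl
    · exact hall k
    · have := mul_mem (hall (k + 1)) hR
      rwa [R_eq, dihElt_mul, Units.val_one, one_smul, one_mul, add_neg_cancel_right] at this

theorem exists_threshold (P : Fin (n + 1) → Prop) (hP : ∀ p q, p ≤ q → P p → P q) :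
    ∃ t ≤ n + 1, ∀ p, P p ↔ t ≤ p.val := by
  classical
  by_cases h : ∃ v, ∃ hv : v < n + 1, P ⟨v, hv⟩
  · obtain ⟨hv, hPv⟩ := Nat.find_spec h
    exact ⟨Nat.find h, hv.le, fun p => ⟨fun hp => Nat.find_min' h ⟨p.2, hp⟩,
      fun hp => hP ⟨_, hv⟩ p hp hPv⟩⟩
  · exact ⟨n + 1, le_rfl, fun p => ⟨fun hp => absurd ⟨p.1, p.2, hp⟩ h,
      fun hp => absurd p.2 (not_lt.2 hp)⟩⟩

theorem pull_dihElt (ε : ℤˣ) (k : Fin (m + 1)) (φ : Fin (n + 1) →o Fin (m + 1)) :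
    ∃ κ, (dihElt ε k).pull φ = dihElt ε κ := by
  suffices h : ∃ κ, ((dihElt ε k).pull φ).perm = (dihElt ε κ).perm from
    h.imp fun κ hκ => Hyp.ext rfl hκ
  have hφ : ∀ p q : Fin (n + 1), p.val ≤ q.val → (φ p).val ≤ (φ q).val :=
    fun p q h => φ.monotone h
  rcases Int.units_eq_one_or ε with rfl | rfl
  · obtain ⟨t, ht, hU⟩ := exists_threshold (fun p => m + 1 ≤ k.val + (φ p).val)
      (fun p q h h' => by have := hφ p q h; omega)
    by_cases h0 : t = 0
    · refine ⟨0, perm_eq_of_lt fun p q h => ?_⟩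
      rw [Hyp.pull_lt_iff] at h
      simp only [dihElt_perm, dihElt_lab, Units.val_one, one_smul, Fin.lt_def, Fin.ext_iff,
        Fin.val_add_eq_ite, zero_add] at h ⊢
      have := hU p; have := hU q; have := hφ p q; have := hφ q p
      have := (φ p).2; have := (φ q).2
      split_ifs at h <;> simp at h <;> omega
    · refine ⟨⟨n + 1 - t, by omega⟩, perm_eq_of_lt fun p q h => ?_⟩
      rw [Hyp.pull_lt_iff] at h
      simp only [dihElt_perm, dihElt_lab, Units.val_one, one_smul, Fin.lt_def, Fin.ext_iff,
        Fin.val_add_eq_ite] at h ⊢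
      have := hU p; have := hU q; have := hφ p q; have := hφ q p
      have := (φ p).2; have := (φ q).2; have := p.2; have := q.2; have := k.2
      split_ifs at h ⊢ <;> simp at h <;> omega
  · obtain ⟨t, ht, hU⟩ := exists_threshold (fun p => k.val < (φ p).val)
      (fun p q h h' => by have := hφ p q h; omega)
    have hsub : ∀ {r : ℕ} (a b : Fin (r + 1)),
        (a - b).val = if b.val ≤ a.val then a.val - b.val else r + 1 + a.val - b.val := by
      intro r a b
      split_ifs with h
      · exact Fin.coe_sub_iff_le.2 h
      · rw [Fin.coe_sub_iff_lt.2 (not_le.1 h)]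
    refine ⟨⟨if t = 0 then n else t - 1, by split_ifs <;> omega⟩, perm_eq_of_lt fun p q h => ?_⟩
    rw [Hyp.pull_lt_iff] at h
    simp only [dihElt_perm, dihElt_lab, Units.val_neg, Units.val_one, neg_smul, one_smul,
      ← sub_eq_add_neg, Fin.lt_def, Fin.ext_iff, hsub] at h ⊢
    have := hU p; have := hU q; have := hφ p q; have := hφ q p
    have := (φ p).2; have := (φ q).2; have := p.2; have := q.2; have := k.2
    split_ifs at h ⊢ <;> simp at h <;> omega

theorem pull_mem_dihedral {g : Hyp m} (hg : g ∈ Hyp.dihedral m)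
    (φ : Fin (n + 1) →o Fin (m + 1)) : g.pull φ ∈ Hyp.dihedral n := by
  obtain ⟨ε, k, rfl⟩ := (mem_dihedral g).1 hg
  obtain ⟨κ, h⟩ := pull_dihElt ε k φ
  exact (mem_dihedral _).2 ⟨ε, κ, h⟩

end Dihedral

/-- The dihedral category `ΔD`: the subcategory of `ΔH` with the same objects, whose morphisms
are the pairs `(φ, d)` with `d` in the dihedral group `D_{n+1}`. -/
@[ext]
structure DeltaD where
  /-- the number `n` of the object `[n]` -/
  deg : ℕ

instance : SmallCategory DeltaD where
  Hom a b := {x : DHHom a.deg b.deg // x.grp ∈ Hyp.dihedral a.deg}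
  id a := ⟨DHHom.id a.deg, one_mem _⟩
  comp x y := ⟨x.1.comp y.1, mul_mem (pull_mem_dihedral y.2 _) x.2⟩
  id_comp x := Subtype.ext x.1.id_comp
  comp_id x := Subtype.ext x.1.comp_id
  assoc x y z := Subtype.ext (x.1.comp_assoc y.1 z.1)

/-- The inclusion of the subcategory `ΔD` in `ΔH`. -/
def deltaDToDeltaH : DeltaD ⥤ DeltaH where
  obj a := ⟨a.deg⟩
  map x := x.1

/-! ## The right module `B` -/

section ModuleB

variable {n m l : ℕ}

theorem DHHom.toIF_surjective : Function.Surjective (DHHom.toIF : DHHom n m → IFHom n m) := by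
  intro f
  have hlab : ∀ j, ∃ ε, (j, ε) ∈ f.fib (f.toFun j) := by
    intro j
    obtain ⟨⟨a, ε⟩, h, rfl⟩ := List.mem_map.1 ((f.mem_fib (f.toFun j) j).2 rfl)
    exact ⟨ε, h⟩
  choose lab hlab using hlab
  let key : Fin (n + 1) → Fin (m + 1) ×ₗ ℕ := fun j =>
    toLex (f.toFun j, ((f.fib (f.toFun j)).map Prod.fst).idxOf j)
  have hmono := Tuple.monotone_sort key
  let x : DHHom n m :=
    { ord :=
        { toFun := fun p => f.toFun (Tuple.sort key p)
          monotone' := fun p q h => by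
            rcases Prod.Lex.le_iff.1 (hmono h) with h | h
            · exact le_of_lt h
            · exact le_of_eq h.1 }
      grp := ⟨lab, (Tuple.sort key)⁻¹⟩ }
  have hx : ∀ j, x.toFun j = f.toFun j := fun j =>
    congrArg f.toFun (perm_apply_inv (Tuple.sort key) j)
  refine ⟨x, IFHom.ext_fib (funext fun i => (x.eq_fib i _ (fun q => ?_) ?_).symm)⟩
  · rw [hx]
    constructor
    · intro hq
      have h1 : f.toFun q.1 = i := (f.mem_fib i q.1).1 (List.mem_map_of_mem hq)
      refine ⟨h1, ?_⟩
      have h2 := hlab q.1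
      rw [h1] at h2
      exact congrArg Prod.snd (List.inj_on_of_nodup_map (f.nodup_fib i) h2 hq rfl)
    · rintro ⟨rfl, h⟩
      have h2 := hlab q.1
      rw [show lab q.1 = q.2 from h] at h2
      exact h2
  · rw [List.pairwise_iff_getElem]
    intro a b ha hb hab
    have hf : ∀ c (hc : c < (f.fib i).length), f.toFun ((f.fib i)[c]).1 = i := fun c hc =>
      (f.mem_fib i _).1 (List.mem_map_of_mem (List.getElem_mem hc))
    have hidx : ∀ c (hc : c < (f.fib i).length),
        ((f.fib i).map Prod.fst).idxOf ((f.fib i)[c]).1 = c := fun c hc => by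
      have := (f.nodup_fib i).idxOf_getElem c (by simpa using hc)
      simpa using this
    by_contra hc
    have h := hmono (not_lt.1 hc)
    simp only [x, Function.comp_apply, perm_apply_inv] at h
    simp only [key, hf, hidx] at h
    rcases Prod.Lex.le_iff.1 h with h | h
    · exact lt_irrefl _ h
    · exact absurd h.2 (not_le.2 hab)

/-- The automorphism `g ∈ H_{n+1}` of `[n]` in `ΔH`. -/
def DHHom.ofGrp (g : Hyp n) : DHHom n n := ⟨OrderHom.id, g⟩

theorem Hyp.pull_id (g : Hyp n) : g.pull OrderHom.id = g := by
  refine Hyp.ext rfl (perm_eq_of_lt fun i j h => ?_)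
  rw [Hyp.pull_lt_iff] at h
  rcases h with h | ⟨h, h' | h'⟩
  · exact h
  · exact absurd h h'.2.ne
  · exact absurd h h'.2.ne'

theorem DHHom.ofGrp_comp (h : Hyp n) (φ : Fin (n + 1) →o Fin (m + 1)) (d : Hyp n) :
    (DHHom.ofGrp h).comp ⟨φ, d⟩ = ⟨φ, d * h⟩ := by
  have hp : d.push OrderHom.id = OrderHom.id := by
    ext p
    simp [Hyp.push, Hyp.pull_id]
  simp only [DHHom.comp, DHHom.ofGrp, hp, Hyp.pull_id]
  rfl

/-- The unique factorization of hyperoctahedral morphisms as a morphism of `H^+` followed by a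
morphism of `ΔD`. -/
theorem DHHom.existsUnique_plus (x : DHHom n m) :
    ∃! h : Hyp.plus n, ∃ δ : DHHom n m, δ.grp ∈ Hyp.dihedral n ∧
      x = (DHHom.ofGrp h.1).comp δ := by
  have hd : dihElt (x.grp.lab 0) (x.grp.perm 0) ∈ Hyp.dihedral n := (mem_dihedral _).2 ⟨_, _, rfl⟩
  refine ⟨⟨(dihElt (x.grp.lab 0) (x.grp.perm 0))⁻¹ * x.grp, ?_, ?_⟩,
    ⟨⟨x.ord, dihElt (x.grp.lab 0) (x.grp.perm 0)⟩, hd, ?_⟩, ?_⟩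
  · simp
  · rw [Hyp.mul_perm, Hyp.inv_perm, Equiv.Perm.mul_apply, Equiv.Perm.inv_eq_iff_eq]
    simp
  · rw [DHHom.ofGrp_comp, mul_inv_cancel_left]
  · rintro ⟨h, h1, h2⟩ ⟨⟨φ, d⟩, hδ, rfl⟩
    obtain ⟨ε, k, rfl⟩ := (mem_dihedral d).1 hδ
    rw [DHHom.ofGrp_comp]
    apply Subtype.ext
    simp [h1, h2]

theorem IFHom.existsUnique_plus (f : IFHom n m) :
    ∃! h : Hyp.plus n, ∃ δ : DHHom n m, δ.grp ∈ Hyp.dihedral n ∧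
      f = (DHHom.ofGrp h.1).toIF.comp δ.toIF := by
  obtain ⟨x, rfl⟩ := DHHom.toIF_surjective f
  simp only [← DHHom.toIF_comp, DHHom.toIF_injective.eq_iff]
  exact x.existsUnique_plus

/-- The action of morphisms on `H^+` by pre-composition: `h · f` is the `H^+`-component in the
unique factorization `h ∘ f = δ ∘ (h · f)` with `δ` in `ΔD` and `h · f` in `H^+`. -/
noncomputable def plusAct (f : IFHom n m) (h : Hyp.plus m) : Hyp.plus n :=
  (IFHom.existsUnique_plus (f.comp (DHHom.ofGrp h.1).toIF)).choose

theorem plusAct_spec (f : IFHom n m) (h : Hyp.plus m) :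
    ∃ δ : DHHom n m, δ.grp ∈ Hyp.dihedral n ∧
      f.comp (DHHom.ofGrp h.1).toIF = (DHHom.ofGrp (plusAct f h).1).toIF.comp δ.toIF :=
  (IFHom.existsUnique_plus (f.comp (DHHom.ofGrp h.1).toIF)).choose_spec.1

theorem plusAct_eq (f : IFHom n m) (h : Hyp.plus m) (h' : Hyp.plus n) (δ : DHHom n m)
    (hδ : δ.grp ∈ Hyp.dihedral n)
    (e : f.comp (DHHom.ofGrp h.1).toIF = (DHHom.ofGrp h'.1).toIF.comp δ.toIF) :
    plusAct f h = h' :=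
  (IFHom.existsUnique_plus (f.comp (DHHom.ofGrp h.1).toIF)).unique (plusAct_spec f h) ⟨δ, hδ, e⟩

theorem IFHom.comp_assoc {r : ℕ} (f : IFHom n m) (g : IFHom m l) (h : IFHom l r) :
    (f.comp g).comp h = f.comp (g.comp h) :=
  IFHom.ext_fib (famComp_assoc f.fib g.fib h.fib).symm

theorem plusAct_id (h : Hyp.plus n) : plusAct (IFHom.id n) h = h := by
  refine plusAct_eq _ _ _ (DHHom.id n) (one_mem _) ?_
  rw [DHHom.toIF_id]
  exact IFHom.ext_fib ((famId_famComp _).trans (famComp_famId _).symm)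

theorem plusAct_comp (f : IFHom n m) (g : IFHom m l) (h : Hyp.plus l) :
    plusAct (f.comp g) h = plusAct f (plusAct g h) := by
  obtain ⟨δ, hδ, e⟩ := plusAct_spec g h
  obtain ⟨δ', hδ', e'⟩ := plusAct_spec f (plusAct g h)
  refine plusAct_eq _ _ _ (δ'.comp δ) (mul_mem (pull_mem_dihedral hδ _) hδ') ?_
  rw [IFHom.comp_assoc, e, ← IFHom.comp_assoc, e', IFHom.comp_assoc, DHHom.toIF_comp]

end ModuleB

section FunctorB

variable (k : Type u) [CommRing k]

/-- The functor `B : IF(as)ᵒᵖ → Mod_k`. Since `H^+` is a groupoid without morphisms between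
distinct objects, `B([n])` is the free module on `Hom_{H^+}([n], [n]) = H_{n+1}^+`; morphisms act
by pre-composition. -/
noncomputable def functorB : IFasᵒᵖ ⥤ ModuleCat.{u} k where
  obj a := ModuleCat.of k (Hyp.plus a.unop.deg →₀ k)
  map f := ModuleCat.ofHom (Finsupp.lmapDomain k k (plusAct f.unop))
  map_id a := by
    have : plusAct (𝟙 a.unop) = _root_.id := funext fun h => plusAct_id h
    ext1
    simp only [unop_id, ModuleCat.hom_ofHom, ModuleCat.hom_id, this, Finsupp.lmapDomain_id]
  map_comp f g := by
    have : plusAct (g.unop ≫ f.unop) = plusAct g.unop ∘ plusAct f.unop :=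
      funext fun h => plusAct_comp g.unop f.unop h
    ext1
    simp only [unop_comp, ModuleCat.hom_ofHom, ModuleCat.hom_comp, this, Finsupp.lmapDomain_comp]

/-- The functor `B` on `ΔHᵒᵖ`, by composition with the isomorphism `ΔH ≅ IF(as)`. -/
noncomputable def functorBH : DeltaHᵒᵖ ⥤ ModuleCat.{u} k :=
  deltaHToIF.op ⋙ functorB k

end FunctorB

/-! ## Involutive algebras and bar constructions -/

/-- An involutive `k`-algebra: an associative unital `k`-algebra with an additive,
anti-multiplicative involution `a ↦ star a` (`StarRing`) which fixes the scalars. -/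
class InvolutiveAlgebra (k A : Type*) [CommRing k] [Ring A] [Algebra k A] [StarRing A] :
    Prop where
  star_algebraMap : ∀ c : k, star (algebraMap k A c) = algebraMap k A c

section Bar

open scoped TensorProduct

variable (k : Type u) {A : Type u} [CommRing k] [Ring A] [Algebra k A] [StarRing A]
  [InvolutiveAlgebra k A]

/-- `a^z`: it is `a` for `z = 1` and `star a` for `z = t`. -/
def signPow (z : ℤˣ) : A →ₗ[k] A where
  toFun a := if z = 1 then a else star a
  map_add' a b := by split_ifs <;> simp
  map_smul' c a := by
    split_ifs
    · rfl
    · rw [Algebra.smul_def, star_mul, InvolutiveAlgebra.star_algebraMap, ← Algebra.commutes,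
        ← Algebra.smul_def, RingHom.id_apply]

@[simp] theorem signPow_one (a : A) : signPow k 1 a = a := by simp [signPow]

@[simp] theorem signPow_neg_one (a : A) : signPow k (-1) a = star a := by
  simp [signPow]

theorem signPow_neg (z : ℤˣ) (a : A) : signPow k (-z) a = star (signPow k z a) := by
  rcases Int.units_eq_one_or z with rfl | rfl <;> simp

/-- The product `∏ a_j^z` over an ordered list of labelled elements `j^z`. -/
def listProd {X : Type} (l : List (X × ℤˣ)) (a : X → A) : A :=
  (l.map fun p => signPow k p.2 (a p.1)).prod

theorem listProd_append {X : Type} (l l' : List (X × ℤˣ)) (a : X → A) :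
    listProd k (l ++ l') a = listProd k l a * listProd k l' a := by
  simp [listProd]

theorem listProd_twist {X : Type} (z : ℤˣ) (l : List (X × ℤˣ)) (a : X → A) :
    listProd k (twist z l) a = signPow k z (listProd k l a) := by
  rcases Int.units_eq_one_or z with rfl | rfl
  · simp
  · rw [twist_neg_one, signPow_neg_one]
    induction l with
    | nil => simp [listProd]
    | cons p l ih =>
      rw [List.map_cons, List.reverse_cons, listProd_append, ih]
      simp [listProd, signPow_neg]

theorem listProd_famComp {X Y Z : Type} (F : Y → List (X × ℤˣ)) (G : Z → List (Y × ℤˣ))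
    (a : X → A) (i : Z) :
    listProd k (famComp F G i) a = listProd k (G i) fun j => listProd k (F j) a := by
  rw [famComp]
  induction G i with
  | nil => simp [listProd]
  | cons p l ih =>
    rw [List.flatMap_cons, listProd_append, ih, listProd_twist]
    simp [listProd]

theorem listProd_congr {X : Type} (l : List (X × ℤˣ)) {a b : X → A}
    (h : ∀ j ∈ l.map Prod.fst, a j = b j) : listProd k l a = listProd k l b := by
  unfold listProd
  congr 1
  exact List.map_congr_left fun p hp => by rw [h p.1 (List.mem_map_of_mem hp)]

/-- If `j` occurs once in `l`, the product is of the form `c * (a_j)^z * d`. -/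
theorem listProd_update {X : Type} [DecidableEq X] (l : List (X × ℤˣ))
    (hl : (l.map Prod.fst).Nodup) (a : X → A) (j : X) (hj : j ∈ l.map Prod.fst) :
    ∃ (z : ℤˣ) (c d : A), ∀ x, listProd k l (Function.update a j x) = c * signPow k z x * d := by
  obtain ⟨⟨j', z⟩, hp, rfl⟩ := List.mem_map.1 hj
  obtain ⟨l₁, l₂, rfl⟩ := List.append_of_mem hp
  refine ⟨z, listProd k l₁ a, listProd k l₂ a, fun x => ?_⟩
  rw [List.map_append, List.map_cons, List.nodup_append] at hl
  obtain ⟨_, h2, h3⟩ := hl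
  rw [List.nodup_cons] at h2
  have e1 : listProd k l₁ (Function.update a j' x) = listProd k l₁ a :=
    listProd_congr k _ fun i hi => Function.update_of_ne
      (h3 i hi j' (List.mem_cons_self ..)) _ _
  have e2 : listProd k l₂ (Function.update a j' x) = listProd k l₂ a :=
    listProd_congr k _ fun i hi => Function.update_of_ne
      (fun e => h2.1 (by rw [← e]; exact hi)) _ _
  rw [listProd_append, e1, ← List.singleton_append, listProd_append, e2]
  simp [listProd, mul_assoc]

theorem listProd_family_update {X Y : Type} [DecidableEq X] [DecidableEq Y]
    (F : Y → List (X × ℤˣ)) (hF : IsShuffle F) (a : X → A) (j : X) :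
    ∃ (i : Y) (z : ℤˣ) (c d : A), ∀ x,
      (fun i' => listProd k (F i') (Function.update a j x)) =
        Function.update (fun i' => listProd k (F i') a) i (c * signPow k z x * d) := by
  obtain ⟨i, hi, hu⟩ := hF.2 j
  obtain ⟨z, c, d, h⟩ := listProd_update k (F i) (hF.1 i) a j hi
  refine ⟨i, z, c, d, fun x => funext fun i' => ?_⟩
  by_cases e : i' = i
  · subst e; rw [h, Function.update_self]
  · rw [Function.update_of_ne e]
    refine listProd_congr k _ fun j' hj' => Function.update_of_ne (fun e' => e (hu i' ?_)) _ _
    rw [← e']; exact hj'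

/-- For a family of ordered lists in which each `j ∈ [n]` occurs once, the `k`-linear map
`a_0 ⊗ ⋯ ⊗ a_n ↦ b_0 ⊗ ⋯ ⊗ b_m`, where `b_i = ∏ a_j^z` over the list of `i`. -/
noncomputable def bar {n m : ℕ} (F : Fin (m + 1) → List (Fin (n + 1) × ℤˣ)) (hF : IsShuffle F) :
    (⨂[k] _ : Fin (n + 1), A) →ₗ[k] (⨂[k] _ : Fin (m + 1), A) :=
  PiTensorProduct.lift
    { toFun := fun a => PiTensorProduct.tprod k fun i => listProd k (F i) a
      map_update_add' := fun {hd} a j x y => by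
        obtain rfl : hd = instDecidableEqFin _ := Subsingleton.elim _ _
        obtain ⟨i, z, c, d, key⟩ := listProd_family_update k F hF a j
        simp only [key, map_add, mul_add, add_mul, MultilinearMap.map_update_add]
      map_update_smul' := fun {hd} a j r x => by
        obtain rfl : hd = instDecidableEqFin _ := Subsingleton.elim _ _
        obtain ⟨i, z, c, d, key⟩ := listProd_family_update k F hF a j
        simp only [key, map_smul, mul_smul_comm, smul_mul_assoc,
          MultilinearMap.map_update_smul] }

@[simp] theorem bar_tprod {n m : ℕ} (F : Fin (m + 1) → List (Fin (n + 1) × ℤˣ))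
    (hF : IsShuffle F) (a : Fin (n + 1) → A) :
    bar k F hF (PiTensorProduct.tprod k a) =
      PiTensorProduct.tprod k fun i => listProd k (F i) a :=
  PiTensorProduct.lift.tprod a

theorem isShuffle_famId (X : Type) : IsShuffle (famId X) :=
  ⟨fun i => by simp [famId], fun j => ⟨j, by simp [famId], fun i hi => by
    simpa [famId, eq_comm] using hi⟩⟩

theorem bar_famId (n : ℕ) (h : IsShuffle (famId (Fin (n + 1)))) :
    bar k (A := A) (famId (Fin (n + 1))) h = LinearMap.id := by
  refine PiTensorProduct.ext (MultilinearMap.ext fun a => ?_)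
  simp [famId, listProd]

theorem bar_famComp {n m l : ℕ} (F : Fin (m + 1) → List (Fin (n + 1) × ℤˣ)) (hF : IsShuffle F)
    (G : Fin (l + 1) → List (Fin (m + 1) × ℤˣ)) (hG : IsShuffle G)
    (h : IsShuffle (famComp F G)) :
    bar k (A := A) (famComp F G) h = bar k G hG ∘ₗ bar k F hF := by
  refine PiTensorProduct.ext (MultilinearMap.ext fun a => ?_)
  simp [listProd_famComp]

variable (A)

/-- The hyperoctahedral bar construction `H_A : IF(as) → Mod_k`: it sends `[n]` to `A^{⊗ n+1}` and
`f` to `a_0 ⊗ ⋯ ⊗ a_n ↦ b_0 ⊗ ⋯ ⊗ b_m` with `b_i = ∏ a_j^{z_j}`, the ordered product over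
`f⁻¹(i)`. -/
noncomputable def hyperBar : IFas ⥤ ModuleCat.{u} k where
  obj a := ModuleCat.of k (⨂[k] _ : Fin (a.deg + 1), A)
  map f := ModuleCat.ofHom (bar k (IFHom.fib f) (IFHom.isShuffle f))
  map_id a := by
    ext1
    exact bar_famId k a.deg (isShuffle_famId _)
  map_comp f g := by
    ext1
    exact bar_famComp k _ (IFHom.isShuffle f) _ (IFHom.isShuffle g) (IFHom.isShuffle (f ≫ g))

/-- The hyperoctahedral bar construction `H_A : ΔH → Mod_k`. -/
noncomputable def hyperBarH : DeltaH ⥤ ModuleCat.{u} k :=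
  deltaHToIF ⋙ hyperBar k A

/-- `H_A(φ, g)` for `g = (z; σ)`: the factor `b_i` is the product of the `a_j^{z_j}` over the `j`
with `φ(σ(j)) = i`, in the order of the `σ(j)`. -/
theorem hyperBarH_map {a b : DeltaH} (x : a ⟶ b) (v : Fin (a.deg + 1) → A) :
    ((hyperBarH k A).map x).hom (PiTensorProduct.tprod k v) =
      PiTensorProduct.tprod k fun i : Fin (b.deg + 1) =>
        (((List.finRange (a.deg + 1)).filter fun p => DHHom.ord x p = i).map fun p =>
          signPow k ((DHHom.grp x).lab ((DHHom.grp x).perm⁻¹ p))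
            (v ((DHHom.grp x).perm⁻¹ p))).prod := by
  refine (bar_tprod k (DHHom.toIF x).fib (DHHom.toIF x).isShuffle v).trans ?_
  simp only [listProd, DHHom.toIF, DHHom.fib, List.map_map, Function.comp_def]

end Bar

/-! ## The Loday functor on `ΔDᵒᵖ` and dihedral homology -/

section Loday

variable {n m l : ℕ}

/-- The list of the `s` cyclic successors `a + 1, …, a + s` of `a` in `[m]`. -/
def walk (a : Fin (m + 1)) (s : ℕ) : List (Fin (m + 1)) :=
  (List.range s).map fun i => a + (i + 1) • (1 : Fin (m + 1))

/-- The number of factors of `b_p` in `φ^*(a_0 ⊗ ⋯ ⊗ a_m) = b_0 ⊗ ⋯ ⊗ b_n`: it is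
`φ(p) - φ(p - 1)` for `p > 0`, and `φ(0) + m + 1 - φ(n)` for `p = 0`. -/
def blockLen (φ : Fin (n + 1) →o Fin (m + 1)) (p : Fin (n + 1)) : ℕ :=
  ((φ p : ℕ) + if p = 0 then m + 1 else 0) - φ (p - 1)

/-- The simplicial structure of the Loday functor: for `φ : [n] → [m]`,
`φ^*(a_0 ⊗ ⋯ ⊗ a_m) = b_0 ⊗ ⋯ ⊗ b_n` with `b_p = a_{φ(p-1)+1} ⋯ a_{φ(p)}` for `p > 0` and
`b_0 = a_{φ(n)+1} ⋯ a_m a_0 ⋯ a_{φ(0)}`. -/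
def simpFam (φ : Fin (n + 1) →o Fin (m + 1)) (p : Fin (n + 1)) : List (Fin (m + 1) × ℤˣ) :=
  (walk (φ (p - 1)) (blockLen φ p)).map fun j => (j, 1)

/-- The dihedral structure of the Loday functor: a rotation `d` acts by `b_i = a_{d(i)}`, a
reflection `d` by `b_i = star a_{d(i - 1)}`. -/
def dihFam (d : Hyp n) (i : Fin (n + 1)) : List (Fin (n + 1) × ℤˣ) :=
  if d.lab i = 1 then [(d.perm i, 1)] else [(d.perm (i - 1), -1)]

/-- The family describing the action of `(φ, d) = φ ∘ d` on the Loday functor: first `φ^*`, then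
the action of `d`. -/
def lodayFam (x : DHHom n m) : Fin (n + 1) → List (Fin (m + 1) × ℤˣ) :=
  famComp (simpFam x.ord) (dihFam x.grp)

theorem val_nsmul_one (s : ℕ) : (s • (1 : Fin (m + 1))).val = s % (m + 1) := by
  induction s with
  | zero => simp
  | succ s ih =>
    rw [succ_nsmul, Fin.val_add, ih, Fin.val_one', Nat.mod_add_mod, Nat.add_mod_mod]

theorem val_add_nsmul_one (a : Fin (m + 1)) (s : ℕ) :
    (a + s • (1 : Fin (m + 1))).val = (a.val + s) % (m + 1) := by
  rw [Fin.val_add, val_nsmul_one, Nat.add_mod_mod]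

theorem walk_succ (a : Fin (m + 1)) (s : ℕ) :
    walk a (s + 1) = walk a s ++ [a + (s + 1) • (1 : Fin (m + 1))] := by
  simp [walk, List.range_succ]

theorem walk_add (a : Fin (m + 1)) (s t : ℕ) :
    walk a (s + t) = walk a s ++ walk (a + s • (1 : Fin (m + 1))) t := by
  induction t with
  | zero => simp [walk]
  | succ t ih =>
    rw [← add_assoc, walk_succ, ih, walk_succ, List.append_assoc]
    simp [add_smul, add_assoc]

theorem blockLen_add (φ : Fin (n + 1) →o Fin (m + 1)) (p : Fin (n + 1)) :
    blockLen φ p + φ (p - 1) = φ p + if p = 0 then m + 1 else 0 := by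
  unfold blockLen
  refine Nat.sub_add_cancel ?_
  split_ifs with h
  · have := (φ (p - 1)).2; omega
  · have : p - 1 ≤ p := by
      rw [Fin.le_def, Fin.val_sub_one_of_ne_zero h]; omega
    simpa using φ.monotone this

theorem add_blockLen (φ : Fin (n + 1) →o Fin (m + 1)) (p : Fin (n + 1)) :
    φ (p - 1) + blockLen φ p • (1 : Fin (m + 1)) = φ p := by
  apply Fin.ext
  rw [val_add_nsmul_one, add_comm, blockLen_add]
  have := (φ p).2
  split_ifs
  · rw [Nat.add_mod_right, Nat.mod_eq_of_lt this]
  · rw [add_zero, Nat.mod_eq_of_lt this]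

/-- Consecutive blocks concatenate. -/
theorem walk_flatMap (ψ : Fin (m + 1) →o Fin (l + 1)) (a : Fin (m + 1)) (s : ℕ) :
    ∃ r, (walk a s).flatMap (fun j => walk (ψ (j - 1)) (blockLen ψ j)) = walk (ψ a) r ∧
      r + ψ a = ψ (a + s • (1 : Fin (m + 1))) + (l + 1) * ((a + s) / (m + 1)) := by
  induction s with
  | zero =>
    refine ⟨0, by simp [walk], ?_⟩
    simp [Nat.div_eq_of_lt a.2]
  | succ s ih =>
    obtain ⟨r, h1, h2⟩ := ih
    have hj : a + (s + 1) • (1 : Fin (m + 1)) - 1 = a + s • (1 : Fin (m + 1)) := by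
      rw [succ_nsmul, ← add_assoc, add_sub_cancel_right]
    have hr : ψ a + r • (1 : Fin (l + 1)) = ψ (a + s • (1 : Fin (m + 1))) := by
      apply Fin.ext
      rw [val_add_nsmul_one, add_comm, h2, Nat.add_mul_mod_self_left,
        Nat.mod_eq_of_lt (Fin.is_lt _)]
    refine ⟨r + blockLen ψ (a + (s + 1) • (1 : Fin (m + 1))), ?_, ?_⟩
    · rw [walk_succ, List.flatMap_append, h1, walk_add, hr]
      simp [hj]
    · have h3 := blockLen_add ψ (a + (s + 1) • (1 : Fin (m + 1)))
      rw [hj] at h3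
      have h4 : (a + (s + 1) • (1 : Fin (m + 1)) = 0) ↔ m + 1 ∣ a.val + s + 1 := by
        rw [Fin.ext_iff, val_add_nsmul_one, Nat.dvd_iff_mod_eq_zero]
        rfl
      simp only [h4] at h3
      have h5 : (a.val + (s + 1)) / (m + 1) =
          (a.val + s) / (m + 1) + if m + 1 ∣ a.val + s + 1 then 1 else 0 :=
        Nat.succ_div
      rw [h5, mul_add]
      split_ifs at h3 ⊢ <;> omega

theorem simpFam_comp (φ : Fin (n + 1) →o Fin (m + 1)) (ψ : Fin (m + 1) →o Fin (l + 1)) :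
    simpFam (ψ.comp φ) = famComp (simpFam ψ) (simpFam φ) := by
  funext p
  obtain ⟨r, h1, h2⟩ := walk_flatMap ψ (φ (p - 1)) (blockLen φ p)
  rw [add_blockLen, add_comm (φ (p - 1) : ℕ), blockLen_add] at h2
  have h3 := blockLen_add (ψ.comp φ) p
  have hr : r = blockLen (ψ.comp φ) p := by
    have := (φ p).2
    simp only [OrderHom.comp_coe, Function.comp_apply] at h3
    split_ifs at h2 h3
    · rw [Nat.add_div_right _ (Nat.succ_pos m), Nat.div_eq_of_lt this] at h2
      omega
    · rw [add_zero, Nat.div_eq_of_lt this] at h2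
      omega
  simp only [famComp, simpFam, List.flatMap_map, twist_one, ← List.map_flatMap, h1, hr]
  rfl

theorem finRange_eq_walk : List.finRange (n + 1) = walk (-1 : Fin (n + 1)) (n + 1) := by
  refine List.ext_getElem (by simp [walk]) fun i h1 h2 => ?_
  have hi : i < n + 1 := by simpa using h1
  apply Fin.ext
  simp only [List.getElem_finRange, walk, List.getElem_map, List.getElem_range]
  have h3 : (-1 : Fin (n + 1)) + (i + 1) • (1 : Fin (n + 1)) = i • (1 : Fin (n + 1)) := by
    rw [succ_nsmul]; abel
  rw [h3, val_nsmul_one, Nat.mod_eq_of_lt hi]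
  rfl

theorem nodup_walk (a : Fin (m + 1)) : (walk a (m + 1)).Nodup := by
  refine List.Nodup.map_on (fun i hi j hj h => ?_) List.nodup_range
  rw [List.mem_range] at hi hj
  have h' := add_left_cancel h
  rw [succ_nsmul, succ_nsmul] at h'
  have h'' := congrArg Fin.val (add_right_cancel h')
  rwa [val_nsmul_one, val_nsmul_one, Nat.mod_eq_of_lt hi, Nat.mod_eq_of_lt hj] at h''

theorem isShuffle_simpFam (φ : Fin (n + 1) →o Fin (m + 1)) : IsShuffle (simpFam φ) := by
  have hfst : ∀ p, (simpFam φ p).map Prod.fst = walk (φ (p - 1)) (blockLen φ p) := fun p => by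
    simp [simpFam, Function.comp_def]
  have htot : (List.finRange (n + 1)).flatMap (fun p => (simpFam φ p).map Prod.fst) =
      walk (φ (-1)) (m + 1) := by
    simp only [hfst]
    obtain ⟨r, h1, h2⟩ := walk_flatMap φ (-1) (n + 1)
    rw [finRange_eq_walk, h1]
    congr 1
    have h0 : (n + 1) • (1 : Fin (n + 1)) = 0 := by
      apply Fin.ext
      rw [val_nsmul_one, Nat.mod_self]
      rfl
    rw [h0, add_zero, Nat.add_div_right _ (Nat.succ_pos n), Nat.div_eq_of_lt (Fin.is_lt _)] at h2
    omega
  have hnd : ((List.finRange (n + 1)).flatMap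
      (fun p => (simpFam φ p).map Prod.fst)).Nodup := htot ▸ nodup_walk _
  have hall : ∀ j, j ∈ walk (φ (-1)) (m + 1) := fun j => by
    have hc : (walk (φ (-1)) (m + 1)).toFinset = Finset.univ := by
      rw [← Finset.card_eq_iff_eq_univ, List.toFinset_card_of_nodup (nodup_walk _)]
      simp [walk]
    rw [← List.mem_toFinset, hc]
    exact Finset.mem_univ _
  rw [List.nodup_flatMap] at hnd
  refine ⟨fun i => hnd.1 i (List.mem_finRange _), fun j => ?_⟩
  obtain ⟨p, _, hp⟩ := List.mem_flatMap.1 (htot ▸ hall j)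
  refine ⟨p, hp, fun q hq => ?_⟩
  by_contra hne
  rcases lt_or_gt_of_ne hne with h | h
  · exact List.pairwise_iff_getElem.1 hnd.2 q p (by simpa using q.2) (by simpa using p.2) h
      (by simpa using hq) (by simpa using hp)
  · exact List.pairwise_iff_getElem.1 hnd.2 p q (by simpa using p.2) (by simpa using q.2) h
      (by simpa using hp) (by simpa using hq)

theorem dihFam_dihElt (ε : ℤˣ) (k i : Fin (n + 1)) :
    dihFam (dihElt ε k) i =
      [((dihElt ε k).perm (if ε = 1 then i else i - 1), ε)] := by
  rcases Int.units_eq_one_or ε with rfl | rfl <;> simp [dihFam]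

theorem isShuffle_dihFam {d : Hyp n} (hd : d ∈ Hyp.dihedral n) : IsShuffle (dihFam d) := by
  obtain ⟨ε, k, rfl⟩ := (mem_dihedral d).1 hd
  refine ⟨fun i => by simp [dihFam_dihElt], fun j => ?_⟩
  simp only [dihFam_dihElt, List.map_cons, List.map_nil, List.mem_singleton]
  rcases Int.units_eq_one_or ε with rfl | rfl
  · refine ⟨(dihElt 1 k).perm.symm j, by simp only [if_true, Equiv.apply_symm_apply], ?_⟩
    rintro i rfl
    simp only [if_true, Equiv.symm_apply_apply]
  · have h : ((-1 : ℤˣ) = 1) ↔ False := by decide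
    simp only [h, if_false]
    refine ⟨(dihElt (-1) k).perm.symm j + 1, ?_, ?_⟩
    · simp only [add_sub_cancel_right, Equiv.apply_symm_apply]
    · rintro i rfl
      simp only [Equiv.symm_apply_apply, sub_add_cancel]

theorem dihFam_mul {d e : Hyp n} (hd : d ∈ Hyp.dihedral n) (he : e ∈ Hyp.dihedral n) :
    dihFam (d * e) = famComp (dihFam d) (dihFam e) := by
  obtain ⟨ε, k, rfl⟩ := (mem_dihedral d).1 hd
  obtain ⟨δ, j, rfl⟩ := (mem_dihedral e).1 he
  funext i
  rw [dihElt_mul]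
  simp only [famComp, dihFam_dihElt]
  rcases Int.units_eq_one_or ε with rfl | rfl <;> rcases Int.units_eq_one_or δ with rfl | rfl <;>
    simp [twist_neg_one] <;> abel

theorem blockLen_eq_top (φ : Fin (n + 1) →o Fin (m + 1)) (p : Fin (n + 1)) :
    blockLen φ p = m + 1 ↔ p = 0 ∧ ∀ q, φ q = φ 0 := by
  have h := blockLen_add φ p
  have hlt := (φ p).2
  constructor
  · intro h'
    by_cases h0 : p = 0
    · subst h0
      refine ⟨rfl, fun q => le_antisymm ?_ (φ.monotone (Fin.zero_le q))⟩
      have hq : q ≤ 0 - 1 := by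
        have : (0 - 1 : Fin (n + 1)) = Fin.last n := by
          rw [sub_eq_iff_eq_add]; exact (Fin.last_add_one n).symm
        rw [this]; exact Fin.le_last q
      refine (φ.monotone hq).trans (Fin.le_def.2 ?_)
      rw [if_pos rfl] at h
      omega
    · rw [if_neg h0] at h; omega
  · rintro ⟨rfl, h'⟩
    rw [if_pos rfl, h' (0 - 1)] at h
    omega

theorem blockLen_eq (φ φ' : Fin (n + 1) →o Fin (m + 1)) (p q : Fin (n + 1))
    (h1 : blockLen φ p • (1 : Fin (m + 1)) = blockLen φ' q • (1 : Fin (m + 1)))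
    (h2 : blockLen φ p = m + 1 ↔ blockLen φ' q = m + 1) : blockLen φ p = blockLen φ' q := by
  have hle : ∀ (φ : Fin (n + 1) →o Fin (m + 1)) (p), blockLen φ p ≤ m + 1 := by
    intro φ p
    by_cases h0 : p = 0
    · subst h0
      have h := blockLen_add φ 0
      have : (φ 0 : ℕ) ≤ φ (0 - 1) := φ.monotone (Fin.zero_le _)
      rw [if_pos rfl] at h
      omega
    · have h := blockLen_add φ p
      rw [if_neg h0] at h
      have := (φ p).2
      omega
  by_cases h : blockLen φ p = m + 1
  · rw [h, h2.1 h]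
  · have ha := (hle φ p).lt_of_ne h
    have hb := (hle φ' q).lt_of_ne fun e => h (h2.2 e)
    have h3 := congrArg Fin.val h1
    rwa [val_nsmul_one, val_nsmul_one, Nat.mod_eq_of_lt ha, Nat.mod_eq_of_lt hb] at h3

theorem add_cancel_aux {G : Type} [AddCommGroup G] (a b c d : G)
    (h : a + b + c = a + (b + d)) : c = d := by
  rw [add_assoc] at h
  exact add_left_cancel (add_left_cancel h)

theorem add_cancel_aux' {G : Type} [AddCommGroup G] (a b c d : G)
    (h : a + -(b + d) + c = a + -b) : c = d := by
  rw [add_assoc] at h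
  have h' := add_left_cancel h
  rw [neg_add_eq_iff_eq_add] at h'
  rw [h']; abel

theorem simpFam_push {e : Hyp m} (he : e ∈ Hyp.dihedral m) (φ : Fin (n + 1) →o Fin (m + 1)) :
    famComp (simpFam (e.push φ)) (dihFam (e.pull φ)) = famComp (dihFam e) (simpFam φ) := by
  obtain ⟨ε, k, rfl⟩ := (mem_dihedral e).1 he
  obtain ⟨κ, hκ⟩ := pull_dihElt ε k φ
  have hpush : ∀ p, (dihElt ε k).push φ ((dihElt ε κ).perm p) = (dihElt ε k).perm (φ p) :=
    fun p => by rw [← hκ, Hyp.push_pull]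
  have hconst : (∀ q, (dihElt ε k).push φ q = (dihElt ε k).push φ 0) ↔ ∀ q, φ q = φ 0 := by
    constructor
    · intro h q
      apply (dihElt ε k).perm.injective
      rw [← hpush, ← hpush, h, h ((dihElt ε κ).perm 0)]
    · intro h q
      obtain ⟨q, rfl⟩ := (dihElt ε κ).perm.surjective q
      obtain ⟨q', hq'⟩ := (dihElt ε κ).perm.surjective 0
      rw [hpush, ← hq', hpush, h q, h q']
  rw [hκ]
  funext i
  simp only [famComp, dihFam_dihElt, List.flatMap_cons, List.flatMap_nil, List.append_nil]
  rcases Int.units_eq_one_or ε with rfl | rfl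
  · have hprev : (dihElt 1 κ).perm i - 1 = (dihElt 1 κ).perm (i - 1) := by
      simp only [dihElt_perm, Units.val_one, one_smul]; abel
    have hlen : blockLen ((dihElt 1 k).push φ) ((dihElt 1 κ).perm i) = blockLen φ i := by
      refine blockLen_eq _ _ _ _ ?_ ?_
      · have h1 := add_blockLen ((dihElt 1 k).push φ) ((dihElt 1 κ).perm i)
        rw [hprev, hpush, hpush] at h1
        have h2 := add_blockLen φ i
        rw [← h2] at h1
        generalize blockLen ((dihElt 1 k).push φ) ((dihElt 1 κ).perm i) = B at h1 ⊢
        simp only [dihElt_perm, Units.val_one, one_smul] at h1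
        exact add_cancel_aux _ _ _ _ h1
      · rw [blockLen_eq_top, blockLen_eq_top, hconst]
        refine and_congr_left fun hc => ?_
        have : (dihElt 1 κ).perm = 1 := by
          refine (perm_eq_of_lt fun a b hab => ?_).symm
          rw [← hκ, Hyp.pull_lt_iff]
          exact Or.inr ⟨by rw [hc a, hc b], Or.inl ⟨rfl, hab⟩⟩
        rw [this, Equiv.Perm.one_apply]
    simp only [if_true, twist_one, simpFam, hlen, hprev, hpush, List.flatMap_map]
    simp only [walk, List.map_map, List.flatMap_map, Function.comp_def,
      ← List.map_eq_flatMap, dihElt_perm, Units.val_one, one_smul, add_assoc]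
  · have hne : ((-1 : ℤˣ) = 1) ↔ False := by decide
    have hprev : (dihElt (-1) κ).perm (i - 1) - 1 = (dihElt (-1) κ).perm i := by
      simp only [dihElt_perm, Units.val_neg, Units.val_one, neg_smul, one_smul]; abel
    have hlen : blockLen ((dihElt (-1) k).push φ) ((dihElt (-1) κ).perm (i - 1)) =
        blockLen φ i := by
      refine blockLen_eq _ _ _ _ ?_ ?_
      · have h1 := add_blockLen ((dihElt (-1) k).push φ) ((dihElt (-1) κ).perm (i - 1))
        rw [hprev, hpush, hpush] at h1
        have h2 := add_blockLen φ i
        rw [← h2] at h1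
        generalize blockLen ((dihElt (-1) k).push φ) ((dihElt (-1) κ).perm (i - 1)) = B at h1 ⊢
        simp only [dihElt_perm, Units.val_neg, Units.val_one, neg_smul, one_smul] at h1
        exact add_cancel_aux' _ _ _ _ h1
      · rw [blockLen_eq_top, blockLen_eq_top, hconst]
        refine and_congr_left fun hc => ?_
        have : (dihElt (-1) κ).perm = Fin.revPerm := by
          refine (perm_eq_of_lt fun a b hab => ?_).symm
          rw [← hκ, Hyp.pull_lt_iff]
          exact Or.inr ⟨by rw [hc a, hc b], Or.inr ⟨rfl, Fin.rev_lt_rev.1 hab⟩⟩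
        rw [this, Fin.revPerm_apply, rev_eq]
        constructor
        · intro h
          have : -i = 0 := by rw [← h]; abel
          exact neg_eq_zero.1 this
        · rintro rfl; abel
    simp only [hne, if_false, twist_neg_one, simpFam, hlen, hprev, hpush, List.flatMap_map]
    have hφ := add_blockLen φ i
    refine List.ext_getElem (by simp [walk, ← List.map_eq_flatMap]) fun s hs1 hs2 => ?_
    have hs : s < blockLen φ i := by simpa [walk] using hs1
    simp only [walk, List.map_map, List.flatMap_map, ← List.map_eq_flatMap, Function.comp_def,
      twist_one, List.getElem_reverse, List.getElem_map, List.getElem_range, List.length_map,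
      List.length_range]
    rw [← hφ]
    obtain ⟨r, hr⟩ : ∃ r, blockLen φ i = r + s + 1 := ⟨blockLen φ i - s - 1, by omega⟩
    rw [hr]
    have : r + s + 1 - 1 - s = r := by omega
    rw [this]
    simp only [dihElt_perm, Units.val_neg, Units.val_one, neg_smul, one_smul, add_smul]
    refine Prod.ext ?_ rfl
    dsimp only
    abel

theorem lodayFam_comp {x : DHHom n m} {y : DHHom m l} (hx : x.grp ∈ Hyp.dihedral n)
    (hy : y.grp ∈ Hyp.dihedral m) :
    lodayFam (x.comp y) = famComp (lodayFam y) (lodayFam x) := by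
  unfold lodayFam
  simp only [DHHom.comp]
  rw [simpFam_comp, dihFam_mul (pull_mem_dihedral hy _) hx, ← famComp_assoc,
    famComp_assoc (simpFam (y.grp.push x.ord)), simpFam_push hy, ← famComp_assoc, famComp_assoc]

theorem isShuffle_lodayFam {x : DHHom n m} (hx : x.grp ∈ Hyp.dihedral n) :
    IsShuffle (lodayFam x) :=
  (isShuffle_simpFam _).comp (isShuffle_dihFam hx)

theorem simpFam_id : simpFam (OrderHom.id : Fin (n + 1) →o Fin (n + 1)) = famId _ := by
  funext p
  have h := blockLen_add (OrderHom.id : Fin (n + 1) →o Fin (n + 1)) p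
  have hlen : blockLen (OrderHom.id : Fin (n + 1) →o Fin (n + 1)) p = 1 := by
    simp only [OrderHom.id_coe, _root_.id] at h
    by_cases h0 : p = 0
    · subst h0
      have : (0 - 1 : Fin (n + 1)) = Fin.last n := by
        rw [sub_eq_iff_eq_add]; exact (Fin.last_add_one n).symm
      rw [this] at h
      simp at h
      omega
    · rw [if_neg h0, Fin.val_sub_one_of_ne_zero h0] at h
      have : p.val ≠ 0 := fun e => h0 (Fin.ext e)
      omega
  simp [simpFam, hlen, walk, famId]

theorem lodayFam_id : lodayFam (DHHom.id n) = famId _ := by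
  have : dihFam (1 : Hyp n) = famId _ := by
    funext i; simp [dihFam, famId]
  simp only [lodayFam, DHHom.id, simpFam_id, this, famComp_famId]

variable (k A : Type u) [CommRing k] [Ring A] [Algebra k A] [StarRing A] [InvolutiveAlgebra k A]

open scoped TensorProduct

/-- The Loday functor (dihedral bar construction) `L(A) : ΔDᵒᵖ → Mod_k`. -/
noncomputable def loday : DeltaDᵒᵖ ⥤ ModuleCat.{u} k where
  obj a := ModuleCat.of k (⨂[k] _ : Fin (a.unop.deg + 1), A)
  map f := ModuleCat.ofHom (bar k (lodayFam f.unop.1) (isShuffle_lodayFam f.unop.2))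
  map_id a := by
    ext1
    have h : lodayFam (𝟙 a.unop : a.unop ⟶ a.unop).1 = famId _ := lodayFam_id
    simp only [unop_id, h]
    exact bar_famId k a.unop.deg (isShuffle_famId _)
  map_comp f g := by
    ext1
    have h : lodayFam (g.unop ≫ f.unop).1 = famComp (lodayFam f.unop.1) (lodayFam g.unop.1) :=
      lodayFam_comp g.unop.2 f.unop.2
    simp only [unop_comp, h]
    exact bar_famComp k _ (isShuffle_lodayFam f.unop.2) _ (isShuffle_lodayFam g.unop.2)
      ((isShuffle_lodayFam f.unop.2).comp (isShuffle_lodayFam g.unop.2))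

/-- An order-preserving map, as a morphism of `ΔD`. -/
def DeltaD.ofOrd (φ : Fin (n + 1) →o Fin (m + 1)) : (⟨n⟩ : DeltaD) ⟶ ⟨m⟩ :=
  ⟨⟨φ, 1⟩, one_mem _⟩

/-- An element of the dihedral group, as an automorphism in `ΔD`. -/
def DeltaD.ofDih (d : Hyp.dihedral n) : (⟨n⟩ : DeltaD) ⟶ ⟨n⟩ :=
  ⟨⟨OrderHom.id, d.1⟩, d.2⟩

theorem loday_ofOrd (φ : Fin (n + 1) →o Fin (m + 1)) (a : Fin (m + 1) → A) :
    ((loday k A).map (DeltaD.ofOrd φ).op).hom (PiTensorProduct.tprod k a) =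
      PiTensorProduct.tprod k fun p : Fin (n + 1) =>
        ((walk (φ (p - 1)) (blockLen φ p)).map a).prod := by
  have h1 : dihFam (1 : Hyp n) = famId _ := by
    funext i; simp [dihFam, famId]
  have h2 : lodayFam (⟨φ, 1⟩ : DHHom n m) = simpFam φ := by
    simp only [lodayFam, h1, famComp_famId]
  have h3 : ∀ p, listProd k (lodayFam (⟨φ, 1⟩ : DHHom n m) p) a =
      ((walk (φ (p - 1)) (blockLen φ p)).map a).prod := fun p => by
    rw [h2]
    simp [listProd, simpFam, Function.comp_def]
  refine (bar_tprod k _ (isShuffle_lodayFam (one_mem _)) a).trans ?_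
  exact congrArg _ (funext h3)

theorem walk_blockLen_zero {φ : Fin (n + 1) →o Fin (m + 1)} {p} (h : blockLen φ p = 0) :
    walk (φ (p - 1)) (blockLen φ p) = [] := by
  simp [h, walk]

theorem walk_blockLen_one {φ : Fin (n + 1) →o Fin (m + 1)} {p} (h : blockLen φ p = 1) :
    walk (φ (p - 1)) (blockLen φ p) = [φ p] := by
  have := add_blockLen φ p
  rw [h] at this ⊢
  rw [← this]
  rfl

theorem walk_blockLen_two {φ : Fin (n + 1) →o Fin (m + 1)} {p} (h : blockLen φ p = 2) :
    walk (φ (p - 1)) (blockLen φ p) = [φ p - 1, φ p] := by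
  have := add_blockLen φ p
  rw [h] at this ⊢
  rw [← this]
  have e : φ (p - 1) + 2 • (1 : Fin (m + 1)) - 1 = φ (p - 1) + 1 • (1 : Fin (m + 1)) := by abel
  rw [e]
  rfl

theorem val_sub_one (p : Fin (n + 1)) : ((p - 1 : Fin (n + 1)) : ℕ) = if p = 0 then n else p - 1 := by
  split_ifs with h
  · subst h
    have : (0 - 1 : Fin (n + 1)) = Fin.last n := by
      rw [sub_eq_iff_eq_add]; exact (Fin.last_add_one n).symm
    rw [this]; rfl
  · exact Fin.val_sub_one_of_ne_zero h

/-- The face `∂_i`, for `i ≤ n`, on `A^{⊗ n+2}`: it multiplies `a_i` and `a_{i+1}`. -/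
theorem loday_face (i : Fin (n + 1)) (a : Fin (n + 2) → A) :
    ((loday k A).map (DeltaD.ofOrd (Fin.succAboveOrderEmb i.castSucc).toOrderHom).op).hom
        (PiTensorProduct.tprod k a) =
      PiTensorProduct.tprod k fun p : Fin (n + 1) =>
        if p < i then a p.castSucc else if p = i then a p.castSucc * a p.succ else a p.succ := by
  rw [loday_ofOrd]
  congr 1
  funext p
  set φ := (Fin.succAboveOrderEmb i.castSucc).toOrderHom with hφ
  have hval : ∀ q, (φ q : ℕ) = if q < i then (q : ℕ) else q + 1 := fun q => by
    change (i.castSucc.succAbove q : ℕ) = _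
    simp only [Fin.succAbove, Fin.castSucc_lt_castSucc_iff]
    split_ifs <;> simp
  have hb := blockLen_add φ p
  rw [hval, hval] at hb
  simp only [Fin.lt_def, val_sub_one, Fin.ext_iff, Fin.val_zero] at hb
  have hi := i.2
  have hp := p.2
  by_cases h1 : p < i
  · have hlen : blockLen φ p = 1 := by
      rw [Fin.lt_def] at h1; split_ifs at hb <;> omega
    have e : φ p = p.castSucc := Fin.ext (by rw [hval, if_pos h1]; rfl)
    rw [walk_blockLen_one hlen, if_pos h1, e]
    simp
  · have e : φ p = p.succ := Fin.ext (by rw [hval, if_neg h1]; rfl)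
    rw [if_neg h1]
    by_cases h2 : p = i
    · have hlen : blockLen φ p = 2 := by
        rw [Fin.ext_iff] at h2; split_ifs at hb <;> omega
      have e' : φ p - 1 = p.castSucc := by
        rw [e, sub_eq_iff_eq_add]; exact (Fin.coeSucc_eq_succ).symm
      rw [walk_blockLen_two hlen, if_pos h2, e', e]
      simp
    · have hlen : blockLen φ p = 1 := by
        rw [Fin.lt_def] at h1; rw [Fin.ext_iff] at h2; split_ifs at hb <;> omega
      rw [walk_blockLen_one hlen, if_neg h2, e]
      simp

/-- The last face on `A^{⊗ n+2}`: it sends `a_0 ⊗ ⋯ ⊗ a_{n+1}` to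
`a_{n+1} a_0 ⊗ a_1 ⊗ ⋯ ⊗ a_n`. -/
theorem loday_face_last (a : Fin (n + 2) → A) :
    ((loday k A).map (DeltaD.ofOrd (Fin.succAboveOrderEmb (Fin.last (n + 1))).toOrderHom).op).hom
        (PiTensorProduct.tprod k a) =
      PiTensorProduct.tprod k fun p : Fin (n + 1) =>
        if p = 0 then a (Fin.last (n + 1)) * a 0 else a p.castSucc := by
  rw [loday_ofOrd]
  congr 1
  funext p
  set φ := (Fin.succAboveOrderEmb (Fin.last (n + 1))).toOrderHom with hφ
  have e : ∀ q, φ q = q.castSucc := fun q => Fin.succAbove_last_apply q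
  have hb := blockLen_add φ p
  rw [e, e, Fin.val_castSucc, Fin.val_castSucc] at hb
  simp only [val_sub_one, Fin.ext_iff, Fin.val_zero] at hb
  by_cases h : p = 0
  · have hlen : blockLen φ p = 2 := by
      rw [Fin.ext_iff, Fin.val_zero] at h; split_ifs at hb; omega
    have e' : φ p - 1 = Fin.last (n + 1) := by
      rw [e, h, sub_eq_iff_eq_add, Fin.last_add_one]; rfl
    rw [walk_blockLen_two hlen, if_pos h, e', e, h]
    simp
  · have hlen : blockLen φ p = 1 := by
      rw [Fin.ext_iff, Fin.val_zero] at h; split_ifs at hb; omega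
    rw [walk_blockLen_one hlen, if_neg h, e]
    simp

/-- The degeneracy `s_j` on `A^{⊗ n+1}`: it inserts the unit after `a_j`. -/
theorem loday_degeneracy (j : Fin (n + 1)) (a : Fin (n + 1) → A) :
    ((loday k A).map (DeltaD.ofOrd (Fin.predAboveOrderHom j)).op).hom
        (PiTensorProduct.tprod k a) =
      PiTensorProduct.tprod k (j.succ.insertNth (α := fun _ => A) 1 a) := by
  rw [loday_ofOrd]
  congr 1
  funext p
  set φ := Fin.predAboveOrderHom j with hφ
  have hval : ∀ q : Fin (n + 2), (φ q : ℕ) = if (j : ℕ) < q then (q : ℕ) - 1 else q := fun q => by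
    change (j.predAbove q : ℕ) = _
    simp only [Fin.predAbove, Fin.lt_def, Fin.val_castSucc]
    split_ifs <;> simp
  have hb := blockLen_add φ p
  rw [hval, hval] at hb
  simp only [val_sub_one, Fin.ext_iff, Fin.val_zero] at hb
  have hj := j.2
  obtain rfl | ⟨q, rfl⟩ := Fin.eq_self_or_eq_succAbove j.succ p
  · have hlen : blockLen φ j.succ = 0 := by
      rw [Fin.val_succ] at hb; split_ifs at hb <;> first | omega | contradiction
    rw [walk_blockLen_zero hlen, Fin.insertNth_apply_same]
    simp
  · have hs : (j.succ.succAbove q : ℕ) = if (q : ℕ) < j + 1 then (q : ℕ) else q + 1 := by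
      simp only [Fin.succAbove, Fin.lt_def, Fin.val_castSucc, Fin.val_succ]
      split_ifs <;> simp
    have hq := q.2
    have e : φ (j.succ.succAbove q) = q := Fin.ext (by
      rw [hval, hs]; split_ifs <;> omega)
    have hlen : blockLen φ (j.succ.succAbove q) = 1 := by
      generalize ((j.succ.succAbove q : Fin (n + 2)) : ℕ) = w at hb hs
      split_ifs at hb hs <;> omega
    rw [walk_blockLen_one hlen, e, Fin.insertNth_apply_succAbove]
    simp

theorem loday_ofDih (d : Hyp.dihedral n) (a : Fin (n + 1) → A) :
    ((loday k A).map (DeltaD.ofDih d).op).hom (PiTensorProduct.tprod k a) =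
      PiTensorProduct.tprod k fun i : Fin (n + 1) =>
        if d.1.lab i = 1 then a (d.1.perm i) else star (a (d.1.perm (i - 1))) := by
  have h2 : lodayFam (⟨OrderHom.id, d.1⟩ : DHHom n n) = dihFam d.1 := by
    simp only [lodayFam, simpFam_id, famId_famComp]
  have h3 : ∀ i, listProd k (lodayFam (⟨OrderHom.id, d.1⟩ : DHHom n n) i) a =
      if d.1.lab i = 1 then a (d.1.perm i) else star (a (d.1.perm (i - 1))) := fun i => by
    rw [h2, dihFam]
    split_ifs <;> simp [listProd]
  refine (bar_tprod k _ (isShuffle_lodayFam d.2) a).trans ?_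
  exact congrArg _ (funext h3)

theorem T_mem : Hyp.T n ∈ Hyp.dihedral n := Subgroup.subset_closure (by simp)

theorem R_mem : Hyp.R n ∈ Hyp.dihedral n := Subgroup.subset_closure (by simp)

/-- The cyclic operator `t_{n+1} (a_0 ⊗ ⋯ ⊗ a_n) = a_n ⊗ a_0 ⊗ ⋯ ⊗ a_{n-1}`. -/
theorem loday_t (a : Fin (n + 1) → A) :
    ((loday k A).map (DeltaD.ofDih ⟨(Hyp.T n)⁻¹, inv_mem T_mem⟩).op).hom
        (PiTensorProduct.tprod k a) =
      PiTensorProduct.tprod k fun i : Fin (n + 1) => a (i - 1) := by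
  rw [loday_ofDih]
  congr 1
  funext i
  have : (Hyp.T n).perm⁻¹ i = i - 1 := by
    rw [Equiv.Perm.inv_eq_iff_eq]; simp [Hyp.T]
  simp only [Hyp.inv_lab, Hyp.inv_perm, this]
  simp [Hyp.T]

/-- The reflection operator
`r_{n+1} (a_0 ⊗ a_1 ⊗ ⋯ ⊗ a_n) = star a_0 ⊗ star a_n ⊗ ⋯ ⊗ star a_1`. -/
theorem loday_r (a : Fin (n + 1) → A) :
    ((loday k A).map (DeltaD.ofDih ⟨Hyp.R n, R_mem⟩).op).hom (PiTensorProduct.tprod k a) =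
      PiTensorProduct.tprod k fun i : Fin (n + 1) => star (a (-i)) := by
  rw [loday_ofDih]
  congr 1
  funext i
  have h : ((-1 : ℤˣ) = 1) ↔ False := by decide
  have : (i - 1).rev = -i := by rw [rev_eq]; abel
  simp only [Hyp.R, h, if_false, Fin.revPerm_apply, this]

/-- The dihedral homology `HD_⋆(A) = Tor_⋆^{ΔDᵒᵖ}(k^*, L(A))`. -/
noncomputable def dihedralHomology : GradedObject ℕ (ModuleCat.{u} k) :=
  Tor k (constFunctor k (DeltaDᵒᵖ)ᵒᵖ) (loday k A)

end Loday

end DihHom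

/-! Every operator of the Loday functor multiplies, permutes and possibly conjugates tensor factors,
so it is the action of a morphism of involutive non-commutative sets. Hence $\mathcal L(A)=\mathsf
H_A\circ\Lambda$ for a functor $\Lambda\colon\Delta D^{op}\to\mathcal{IF}(as)$ that does not depend
on $A$ (`lodayFunctor`). It is faithful, and its image on morphisms is exactly $\Delta
D\subset\Delta H\cong\mathcal{IF}(as)$: this is the self-duality of the dihedral category
(`exists_dihedral_lodayFam`, `lodayFam_injective`, `dual_surjective`).

By the unique factorization through $H^+$, each $f\colon c\to\Lambda(d)$ is $\Lambda(x)\circ h$ for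
exactly one $h\in H^+_{c}$ and one $x$ in $\Delta D^{op}$. Thus $\mathrm{Hom}(c,\Lambda(-))$ is a
disjoint union, over $h\in H^+_c=S(c)$, of representable functors on $\Delta D^{op}$.
`ElementReflection` isolates this situation for a general $\Phi\colon D\to C$ and a presheaf of sets
$S$ on $C$, and two consequences follow.

(1) There is an isomorphism $k\otimes_D\Phi^*F\cong k[S]\otimes_CF$, natural in $F$ (`coendNatIso`):
a generator $h\otimes x$ corresponds to $1\otimes h_*x$, and $1\otimes y$ to the base element
tensored with $y$.

(2) The restriction $\Phi^*$ sends the free functors at objects of $C$ to sums of free functors,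
hence preserves projectives (`preservesProjectiveObjects`).

As $\Phi^*$ is also exact, it carries a projective resolution of $F$ to one of $\Phi^*F$, and (1)
identifies the two complexes that compute Tor. With $\Phi=\Lambda$, $k[S]=B$ and $F=\mathsf H_A$
this is the first isomorphism.

The second isomorphism is the invariance of Tor under restriction of both variables along an
equivalence, here $\Delta H\to\mathcal{IF}(as)$. It uses the same resolution argument. -/

namespace DihHom

/-! ## Elementwise description of the coend -/

section Coend

variable {k : Type u} [CommRing k] {C : Type} [SmallCategory C]
  {G : Cᵒᵖ ⥤ ModuleCat.{u} k} {F F' : C ⥤ ModuleCat.{u} k}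

/-- The class of `g ⊗ x` in `G ⊗_C F`, for `g ∈ G(c)` and `x ∈ F(c)`. -/
noncomputable def coendTmul (G : Cᵒᵖ ⥤ ModuleCat.{u} k) (F : C ⥤ ModuleCat.{u} k) (c : C) :
    G.obj (Opposite.op c) →ₗ[k] F.obj c →ₗ[k] (tensorOver k G).obj F :=
  TensorProduct.curry (Limits.coend.ι (tensorBifunctor k G F) c).hom

/-- The defining relation of the coend, read on elements: morphisms slide across the tensor sign. -/
theorem coendTmul_map {c c' : C} (f : c ⟶ c') (g : G.obj (Opposite.op c')) (x : F.obj c) :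
    coendTmul G F c (G.map f.op g) x = coendTmul G F c' g (F.map f x) :=
  LinearMap.congr_fun (congrArg ModuleCat.Hom.hom
    (Limits.coend.condition (tensorBifunctor k G F) f)) (TensorProduct.tmul k g x)

/-- The coend is a quotient of $\bigoplus_c G(c)\otimes F(c)$, so pure tensors generate it. -/
theorem coend_hom_ext {M : ModuleCat.{u} k} {φ ψ : (tensorOver k G).obj F ⟶ M}
    (h : ∀ c (g : G.obj (Opposite.op c)) (x : F.obj c),
      φ (coendTmul G F c g x) = ψ (coendTmul G F c g x)) : φ = ψ := by
  refine Limits.coend.hom_ext fun c => ModuleCat.hom_ext (TensorProduct.ext' fun g x => h c g x)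

theorem tensorOver_map_coendTmul (η : F ⟶ F') (c : C) (g : G.obj (Opposite.op c))
    (x : F.obj c) :
    (tensorOver k G).map η (coendTmul G F c g x) = coendTmul G F' c g (η.app c x) :=
  LinearMap.congr_fun (congrArg ModuleCat.Hom.hom
    (Limits.coend.ι_map (F := tensorBifunctor k G F) (F' := tensorBifunctor k G F')
    (Functor.whiskerLeft (G ⋙ MonoidalCategory.curriedTensor (ModuleCat.{u} k))
      ((Functor.whiskeringLeft C (ModuleCat.{u} k) (ModuleCat.{u} k)).map η)) c))
    (TensorProduct.tmul k g x)

/-- The map out of `G ⊗_C F` given by a compatible family of bilinear maps. -/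
noncomputable def coendLift {M : ModuleCat.{u} k}
    (β : ∀ c, G.obj (Opposite.op c) →ₗ[k] F.obj c →ₗ[k] M)
    (hβ : ∀ {c c' : C} (f : c ⟶ c') (g : G.obj (Opposite.op c')) (x : F.obj c),
      β c (G.map f.op g) x = β c' g (F.map f x)) : (tensorOver k G).obj F ⟶ M :=
  Limits.coend.desc (F := tensorBifunctor k G F)
    (fun c => ModuleCat.ofHom (TensorProduct.lift (β c)))
    (fun _ _ f => ModuleCat.hom_ext (TensorProduct.ext' fun g x => hβ f g x))

theorem coendLift_coendTmul {M : ModuleCat.{u} k}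
    (β : ∀ c, G.obj (Opposite.op c) →ₗ[k] F.obj c →ₗ[k] M)
    (hβ : ∀ {c c' : C} (f : c ⟶ c') (g : G.obj (Opposite.op c')) (x : F.obj c),
      β c (G.map f.op g) x = β c' g (F.map f x)) (c : C) (g : G.obj (Opposite.op c))
    (x : F.obj c) : coendLift β hβ (coendTmul G F c g x) = β c g x :=
  LinearMap.congr_fun (congrArg ModuleCat.Hom.hom
    (Limits.coend.ι_desc (F := tensorBifunctor k G F)
    (fun c => ModuleCat.ofHom (TensorProduct.lift (β c)))
    (fun _ _ f => ModuleCat.hom_ext (TensorProduct.ext' fun g x => hβ f g x)) c))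
    (TensorProduct.tmul k g x)

end Coend

/-! ## Functor homology along restriction functors that preserve projectives -/

section Restriction

theorem projective_sigma {V : Type*} [Category* V] {J : Type} (P : J → V)
    [Limits.HasCoproduct P] [∀ j, Projective (P j)] : Projective (∐ P) where
  factors f e _ := ⟨Limits.Sigma.desc fun j => Projective.factorThru (Limits.Sigma.ι P j ≫ f) e,
    Limits.Sigma.hom_ext _ _ fun j => by
      rw [Limits.Sigma.ι_desc_assoc, Projective.factorThru_comp]⟩

variable (k : Type u) [CommRing k] {C D : Type} [SmallCategory C] [SmallCategory D]

/-- The restriction of functors `C ⥤ Mod_k` along `Φ : D ⥤ C`. -/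
abbrev restriction (Φ : D ⥤ C) : (C ⥤ ModuleCat.{u} k) ⥤ (D ⥤ ModuleCat.{u} k) :=
  (Functor.whiskeringLeft D C (ModuleCat.{u} k)).obj Φ

/-- If restriction along `Φ` preserves projectives and `G' ⊗_D Φ^*F ≅ G ⊗_C F` naturally in `F`,
then `Tor^D(G', Φ^*F) ≅ Tor^C(G, F)`. -/
theorem nonempty_tor_iso {Φ : D ⥤ C} [(restriction k Φ).PreservesProjectiveObjects]
    {G : Cᵒᵖ ⥤ ModuleCat.{u} k} {G' : Dᵒᵖ ⥤ ModuleCat.{u} k}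
    (e : restriction k Φ ⋙ tensorOver k G' ≅ tensorOver k G) (F : C ⥤ ModuleCat.{u} k) :
    Nonempty (Tor k G' (Φ ⋙ F) ≅ Tor k G F) := by
  let P := projectiveResolution F
  have : (restriction k Φ).PreservesHomology := inferInstance
  -- Restriction is exact because homology in functor categories is computed objectwise; together
  -- with the preservation of projectives this keeps resolutions.
  let P' : ProjectiveResolution (Φ ⋙ F) := (restriction k Φ).mapProjectiveResolution P
  -- Only here is the naturality of `e` in $F$ needed: it makes the degreewise isomorphisms commute
  -- with the differentials.
  let i : ((tensorOver k G').mapHomologicalComplex _).obj P'.complex ≅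
      ((tensorOver k G).mapHomologicalComplex _).obj P.complex :=
    HomologicalComplex.Hom.isoOfComponents (fun n => e.app (P.complex.X n))
      (fun a b _ => (e.hom.naturality (P.complex.d a b)).symm)
  exact ⟨GradedObject.isoMk _ _ fun n => P'.isoLeftDerivedObj (tensorOver k G') n ≪≫
    (HomologicalComplex.homologyFunctor _ _ n).mapIso i ≪≫
    (P.isoLeftDerivedObj (tensorOver k G) n).symm⟩

end Restriction

/-! ## Presheaves of sets whose elements are locally represented -/

/-- A presheaf of sets `S` on `C` with elements `base d ∈ S(Φ d)`, natural in `d`, such that the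
functor from `D` to the category of elements of `S` has a left adjoint: each `h ∈ S(c)` has a
universal arrow `unit h : c ⟶ Φ (obj h)` along which the base element pulls back to `h`. -/
structure ElementReflection {C D : Type} [SmallCategory C] [SmallCategory D] (Φ : D ⥤ C) where
  /-- the elements over an object -/
  S : C → Type
  /-- the action of a morphism -/
  act : ∀ {c c' : C}, (c ⟶ c') → S c' → S c
  act_id : ∀ {c : C} (h : S c), act (𝟙 c) h = h
  act_comp : ∀ {c c' c'' : C} (f : c ⟶ c') (g : c' ⟶ c'') (h : S c''),
    act (f ≫ g) h = act f (act g h)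
  /-- the base element over `Φ d` -/
  base : ∀ d : D, S (Φ.obj d)
  act_base : ∀ {d d' : D} (x : d ⟶ d'), act (Φ.map x) (base d') = base d
  /-- the object representing an element -/
  obj : ∀ {c : C}, S c → D
  /-- the universal arrow of an element -/
  unit : ∀ {c : C} (h : S c), c ⟶ Φ.obj (obj h)
  act_unit : ∀ {c : C} (h : S c), act (unit h) (base (obj h)) = h
  existsUnique_desc : ∀ {c : C} (h : S c) {d : D} (f : c ⟶ Φ.obj d), act f (base d) = h →
    ∃! x : obj h ⟶ d, unit h ≫ Φ.map x = f

namespace ElementReflection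

variable {C D : Type} [SmallCategory C] [SmallCategory D] {Φ : D ⥤ C}
  (E : ElementReflection Φ)

/-- The morphism induced by a universal arrow. -/
noncomputable def desc {c : C} (h : E.S c) {d : D} (f : c ⟶ Φ.obj d)
    (hf : E.act f (E.base d) = h) : E.obj h ⟶ d :=
  (E.existsUnique_desc h f hf).choose

theorem unit_desc {c : C} (h : E.S c) {d : D} (f : c ⟶ Φ.obj d)
    (hf : E.act f (E.base d) = h) : E.unit h ≫ Φ.map (E.desc h f hf) = f :=
  (E.existsUnique_desc h f hf).choose_spec.1

theorem desc_eq {c : C} (h : E.S c) {d : D} (f : c ⟶ Φ.obj d)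
    (hf : E.act f (E.base d) = h) (x : E.obj h ⟶ d) (hx : E.unit h ≫ Φ.map x = f) :
    E.desc h f hf = x :=
  (E.existsUnique_desc h f hf).unique (E.unit_desc h f hf) hx

/-- Uniqueness of the factorization makes it natural in the target. -/
theorem desc_comp {c : C} (h : E.S c) {d d' : D} (f : c ⟶ Φ.obj d)
    (hf : E.act f (E.base d) = h) (x : d ⟶ d')
    (hf' : E.act (f ≫ Φ.map x) (E.base d') = h) :
    E.desc h (f ≫ Φ.map x) hf' = E.desc h f hf ≫ x := by
  refine E.desc_eq _ _ _ _ ?_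
  rw [Φ.map_comp, ← Category.assoc, unit_desc]

/-! ### The presheaf of modules $k[S]$ and its generators -/

variable (k : Type u) [CommRing k]

/-- The linearization of the presheaf of sets. -/
noncomputable def linearization : Cᵒᵖ ⥤ ModuleCat.{u} k where
  obj a := ModuleCat.of k (E.S a.unop →₀ k)
  map f := ModuleCat.ofHom (Finsupp.lmapDomain k k (E.act f.unop))
  map_id a := by
    have : E.act (𝟙 a.unop) = _root_.id := funext E.act_id
    ext1
    simp only [unop_id, ModuleCat.hom_ofHom, ModuleCat.hom_id, this, Finsupp.lmapDomain_id]
  map_comp f g := by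
    have : E.act (g.unop ≫ f.unop) = E.act g.unop ∘ E.act f.unop :=
      funext fun h => E.act_comp g.unop f.unop h
    ext1
    simp only [unop_comp, ModuleCat.hom_ofHom, ModuleCat.hom_comp, this, Finsupp.lmapDomain_comp]

/-- The multiples of the generator `h` of `k[S(c)]`. -/
noncomputable def gen {c : C} (h : E.S c) : k →ₗ[k] (E.linearization k).obj (Opposite.op c) :=
  Finsupp.lsingle h

theorem linearization_map_gen {c c' : C} (f : c ⟶ c') (h : E.S c') (r : k) :
    (E.linearization k).map f.op (E.gen k h r) = E.gen k (E.act f h) r :=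
  Finsupp.mapDomain_single

theorem linearization_hom_ext {c : C} {M : Type*} [AddCommGroup M] [Module k M]
    {φ ψ : (E.linearization k).obj (Opposite.op c) →ₗ[k] M}
    (H : ∀ h, φ (E.gen k h 1) = ψ (E.gen k h 1)) : φ = ψ :=
  Finsupp.lhom_ext' fun h => LinearMap.ext_ring (H h)

/-- The linear map out of `k[S(c)]` given by its values on generators. -/
noncomputable def genLift {c : C} {M : Type*} [AddCommGroup M] [Module k M] (v : E.S c → M) :
    (E.linearization k).obj (Opposite.op c) →ₗ[k] M :=
  Finsupp.linearCombination k v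

theorem genLift_gen {c : C} {M : Type*} [AddCommGroup M] [Module k M] (v : E.S c → M)
    (h : E.S c) : E.genLift k v (E.gen k h 1) = v h :=
  (Finsupp.linearCombination_single k 1 h).trans (one_smul k _)

/-! ### Comparison of $k\otimes_D\Phi^*F$ with $k[S]\otimes_CF$ -/

variable (F : C ⥤ ModuleCat.{u} k)

/-- The map `F(c) → k ⊗_D Φ^*F`, `x ↦ 1 ⊗ (unit h)_* x`, for `h ∈ S(c)`. -/
noncomputable def toConst {c : C} (h : E.S c) :
    F.obj c →ₗ[k] (tensorOver k (constFunctor k Dᵒᵖ)).obj (Φ ⋙ F) :=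
  coendTmul (constFunctor k Dᵒᵖ) (Φ ⋙ F) (E.obj h) (1 : k) ∘ₗ (F.map (E.unit h)).hom

/-- Any arrow that pulls the base element back to $h$ may replace the universal one: it factors as
`unit h` followed by $\Phi$ of a morphism of $D$, and that morphism slides across the tensor sign,
acting as the identity on the constant module. The well-definedness of the comparison map rests on
this. -/
theorem toConst_apply {c : C} (h : E.S c) {d : D} (f : c ⟶ Φ.obj d)
    (hf : E.act f (E.base d) = h) (x : F.obj c) :
    E.toConst k F h x = coendTmul (constFunctor k Dᵒᵖ) (Φ ⋙ F) d (1 : k) (F.map f x) := by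
  have h1 := coendTmul_map (G := constFunctor k Dᵒᵖ) (F := Φ ⋙ F)
    (E.desc h f hf) (1 : k) (F.map (E.unit h) x)
  have h2 : (Φ ⋙ F).map (E.desc h f hf) (F.map (E.unit h) x) = F.map f x := by
    rw [Functor.comp_map, ← ConcreteCategory.comp_apply, ← F.map_comp, unit_desc]
  rw [h2] at h1
  exact h1

/-- The composite `f ≫ E.unit h` pulls the base element back to `E.act f h`, so it may be used in
place of the universal arrow of that element. -/
theorem toConst_act {c c' : C} (f : c ⟶ c') (h : E.S c') (x : F.obj c) :
    E.toConst k F (E.act f h) x = E.toConst k F h (F.map f x) := by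
  rw [E.toConst_apply k F (E.act f h) (f ≫ E.unit h) (by rw [E.act_comp, E.act_unit]),
    F.map_comp]
  rfl

theorem genLift_toConst_map {c c' : C} (f : c ⟶ c')
    (g : (E.linearization k).obj (Opposite.op c')) (x : F.obj c) :
    E.genLift k (E.toConst k F) ((E.linearization k).map f.op g) x =
      E.genLift k (E.toConst k F) g (F.map f x) := by
  -- With $x$ fixed both sides are linear in $g$, so generators suffice.
  have := E.linearization_hom_ext k
    (φ := (E.genLift k (E.toConst k F)).flip x ∘ₗ ((E.linearization k).map f.op).hom)
    (ψ := (E.genLift k (E.toConst k F)).flip (F.map f x)) fun h => by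
      refine (congrArg (fun y => E.genLift k (E.toConst k F) y x)
        (E.linearization_map_gen k f h 1)).trans ?_
      rw [LinearMap.flip_apply, genLift_gen, genLift_gen, toConst_act]
  exact LinearMap.congr_fun this g

/-- The comparison map `k[S] ⊗_C F ⟶ k ⊗_D Φ^*F`. -/
noncomputable def coendHom :
    (tensorOver k (E.linearization k)).obj F ⟶
      (tensorOver k (constFunctor k Dᵒᵖ)).obj (Φ ⋙ F) :=
  coendLift (fun _ => E.genLift k (E.toConst k F)) (E.genLift_toConst_map k F)

/-- Naturality of the base elements turns the coend relation over $\Phi(x)$ into the relation that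
holds over $x$ with constant left module. -/
theorem coendTmul_gen_base {d d' : D} (x : d ⟶ d') (r : k) (y : F.obj (Φ.obj d)) :
    coendTmul (E.linearization k) F (Φ.obj d) (E.gen k (E.base d) r) y =
      coendTmul (E.linearization k) F (Φ.obj d') (E.gen k (E.base d') r) (F.map (Φ.map x) y) := by
  have h := coendTmul_map (G := E.linearization k) (F := F) (Φ.map x)
    (E.gen k (E.base d') r) y
  rw [linearization_map_gen, E.act_base] at h
  exact h

/-- The comparison map `k ⊗_D Φ^*F ⟶ k[S] ⊗_C F`, given by the base elements. -/
noncomputable def coendInv :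
    (tensorOver k (constFunctor k Dᵒᵖ)).obj (Φ ⋙ F) ⟶
      (tensorOver k (E.linearization k)).obj F :=
  coendLift (G := constFunctor k Dᵒᵖ) (F := Φ ⋙ F)
    (fun d => coendTmul (E.linearization k) F (Φ.obj d) ∘ₗ E.gen k (E.base d))
    (fun x r y => E.coendTmul_gen_base k F x r y)

theorem coendHom_gen {c : C} (h : E.S c) (x : F.obj c) :
    E.coendHom k F (coendTmul (E.linearization k) F c (E.gen k h 1) x) = E.toConst k F h x :=
  (coendLift_coendTmul _ (E.genLift_toConst_map k F) _ _ _).trans (LinearMap.congr_fun (E.genLift_gen k _ h) x)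

theorem coendInv_coendTmul (d : D) (r : k) (x : F.obj (Φ.obj d)) :
    E.coendInv k F (coendTmul (constFunctor k Dᵒᵖ) (Φ ⋙ F) d r x) =
      coendTmul (E.linearization k) F (Φ.obj d) (E.gen k (E.base d) r) x :=
  coendLift_coendTmul (G := constFunctor k Dᵒᵖ) (F := Φ ⋙ F) _
    (fun x r y => E.coendTmul_gen_base k F x r y) _ _ _

/-- The isomorphism `k ⊗_D Φ^*F ≅ k[S] ⊗_C F`. -/
noncomputable def coendIso :
    (tensorOver k (constFunctor k Dᵒᵖ)).obj (Φ ⋙ F) ≅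
      (tensorOver k (E.linearization k)).obj F where
  hom := E.coendInv k F
  inv := E.coendHom k F
  hom_inv_id := by
    refine coend_hom_ext fun d r x => ?_
    rw [ConcreteCategory.comp_apply, ConcreteCategory.id_apply]
    -- By linearity in $r$ it is enough to take $r=1$. The identity of $\Phi(d)$ pulls the base
    -- element back to itself, so `toConst_apply` lets it replace the universal arrow.
    have := LinearMap.ext_ring (R := k)
      (f := ((coendTmul (E.linearization k) F (Φ.obj d)).flip x).comp (E.gen k (E.base d)) |>.comp
        LinearMap.id |> (E.coendHom k F).hom.comp)
      (g := (coendTmul (constFunctor k Dᵒᵖ) (Φ ⋙ F) d).flip x) (by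
        refine (E.coendHom_gen k F (E.base d) x).trans ?_
        refine (E.toConst_apply k F (E.base d) (𝟙 _) (E.act_id _) x).trans ?_
        rw [F.map_id]
        rfl)
    exact (congrArg (E.coendHom k F) (E.coendInv_coendTmul k F d r x)).trans
      (LinearMap.congr_fun this r)
  inv_hom_id := by
    refine coend_hom_ext fun c g x => ?_
    rw [ConcreteCategory.comp_apply, ConcreteCategory.id_apply]
    -- On a generator $h$ the round trip gives the base element tensored with the image of $x$ under
    -- `unit h`; sliding `unit h` back across the tensor sign pulls the base element back to $h$.
    have := E.linearization_hom_ext k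
      (φ := (coendTmul (E.linearization k) F c).flip x |> (E.coendHom k F).hom.comp |>
        (E.coendInv k F).hom.comp)
      (ψ := (coendTmul (E.linearization k) F c).flip x) fun h => by
        refine (congrArg (E.coendInv k F) (E.coendHom_gen k F h x)).trans ?_
        refine (E.coendInv_coendTmul k F (E.obj h) 1 (F.map (E.unit h) x)).trans ?_
        rw [← coendTmul_map, linearization_map_gen, E.act_unit]
        rfl
    exact LinearMap.congr_fun this g

/-- The isomorphism `k ⊗_D Φ^*F ≅ k[S] ⊗_C F`, naturally in `F`. -/
noncomputable def coendNatIso :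
    restriction k Φ ⋙ tensorOver k (constFunctor k Dᵒᵖ) ≅ tensorOver k (E.linearization k) :=
  NatIso.ofComponents (E.coendIso k) fun {F F'} η => by
    refine coend_hom_ext (F := Φ ⋙ F) fun d r x => ?_
    have h1 := tensorOver_map_coendTmul (G := constFunctor k Dᵒᵖ)
      ((restriction k Φ).map η) d r x
    have h2 := tensorOver_map_coendTmul (G := E.linearization k) η (Φ.obj d)
      (E.gen k (E.base d) r) x
    exact (congrArg (E.coendInv k F') h1).trans
      ((E.coendInv_coendTmul k F' d r (η.app _ x)).trans
      (h2.symm.trans (congrArg _ (E.coendInv_coendTmul k F d r x).symm)))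

/-! ### Restriction along $\Phi$ preserves projectives -/

include E in
-- At $d$ the restricted functor is the coproduct of copies of $X$ over the arrows $c\to\Phi(d)$.
-- Sorting these arrows by the element $h\in S(c)$ that they induce decomposes it into the free
-- functors on $X$ at the objects `E.obj h`, and a map out of such a functor is a map out of $X$.
-- The proof lifts directly, without forming the decomposition.
theorem projective_restriction_evaluationLeftAdjoint (c : C) (X : ModuleCat.{u} k)
    [Projective X] :
    Projective ((restriction k Φ).obj ((evaluationLeftAdjoint (ModuleCat.{u} k) c).obj X)) where
  factors {Y Z} f e _ := by
    -- Projectivity of $X$ is used once for each $h$, on the summand of the universal arrow.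
    let β : ∀ h : E.S c, X ⟶ Y.obj (E.obj h) := fun h =>
      Projective.factorThru
        (Limits.Sigma.ι (fun _ : c ⟶ Φ.obj (E.obj h) => X) (E.unit h) ≫ f.app (E.obj h))
        (e.app (E.obj h))
    have hβ : ∀ h, β h ≫ e.app (E.obj h) =
        Limits.Sigma.ι (fun _ : c ⟶ Φ.obj (E.obj h) => X) (E.unit h) ≫ f.app (E.obj h) :=
      fun h => Projective.factorThru_comp _ _
    -- On the summand of any other arrow the lift is forced by naturality: transport along the
    -- induced morphism of $D$.
    let γ : ∀ d, (∐ fun _ : c ⟶ Φ.obj d => X) ⟶ Y.obj d := fun d =>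
      Limits.Sigma.desc fun g => β (E.act g (E.base d)) ≫ Y.map (E.desc _ g rfl)
    -- Keeping `h` apart from `E.act g (E.base d)` permits its use below where the two agree only by
    -- a proved equality, on which the type of `E.desc` depends.
    have hγ : ∀ {d} (g : c ⟶ Φ.obj d) (h) (hg : E.act g (E.base d) = h),
        Limits.Sigma.ι (fun _ : c ⟶ Φ.obj d => X) g ≫ γ d = β h ≫ Y.map (E.desc h g hg) := by
      rintro d g h rfl
      exact Limits.Sigma.ι_desc _ _
    have hmap : ∀ {d d'} (x : d ⟶ d') (g : c ⟶ Φ.obj d),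
        Limits.Sigma.ι (fun _ : c ⟶ Φ.obj d => X) g ≫
          ((restriction k Φ).obj ((evaluationLeftAdjoint (ModuleCat.{u} k) c).obj X)).map x =
        Limits.Sigma.ι (fun _ : c ⟶ Φ.obj d' => X) (g ≫ Φ.map x) := fun x g =>
      Limits.Sigma.ι_desc _ _
    refine ⟨⟨γ, fun d d' x => Limits.Sigma.hom_ext _ _ fun g => ?_⟩,
      NatTrans.ext (funext fun d => Limits.Sigma.hom_ext _ _ fun g => ?_)⟩
    -- Composing with $\Phi(x)$ does not change the induced element, so the same `β` governs both
    -- summands.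
    · have hg : E.act (g ≫ Φ.map x) (E.base d') = E.act g (E.base d) := by
        rw [E.act_comp, E.act_base]
      refine (reassoc_of% hmap x g) _ |>.trans ?_
      refine (hγ _ _ hg).trans ?_
      rw [E.desc_comp _ g rfl, Y.map_comp]
      exact (((Category.assoc _ _ _).symm.trans (congrArg (· ≫ Y.map x) (hγ g _ rfl))).trans
        (Category.assoc _ _ _)).symm
    · refine ((Category.assoc _ _ _).symm.trans
        (congrArg (· ≫ e.app d) (hγ g _ rfl))).trans ?_
      rw [Category.assoc, e.naturality, reassoc_of% hβ]
      refine (Category.assoc _ _ _).trans ?_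
      refine (congrArg (Limits.Sigma.ι _ _ ≫ ·) (f.naturality _).symm).trans ?_
      refine (reassoc_of% hmap _ _) _ |>.trans ?_
      rw [unit_desc]
      rfl

include E in
-- A projective functor is a retract of a coproduct of free functors at objects; restriction
-- preserves coproducts and retracts, and the free functors are covered by the preceding lemma.
theorem preservesProjectiveObjects : (restriction k Φ).PreservesProjectiveObjects where
  projective_obj {F} hF := by
    let P : C → (C ⥤ ModuleCat.{u} k) := fun c =>
      (evaluationLeftAdjoint (ModuleCat.{u} k) c).obj (Projective.over (F.obj c))
    let q : ∀ c, P c ⟶ F := fun c =>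
      ((evaluationAdjunctionRight (ModuleCat.{u} k) c).homEquiv _ _).symm (Projective.π (F.obj c))
    have hq : Epi (Limits.Sigma.desc q) := by
      have : ∀ c, Epi ((Limits.Sigma.desc q).app c) := by
        intro c
        have h : ((evaluationAdjunctionRight (ModuleCat.{u} k) c).homEquiv _ _)
            (Limits.Sigma.ι P c ≫ Limits.Sigma.desc q) = Projective.π (F.obj c) := by
          rw [Limits.Sigma.ι_desc]
          exact Equiv.apply_symm_apply _ _
        rw [Adjunction.homEquiv_unit] at h
        refine @epi_of_epi_fac _ _ _ _ _
          ((evaluationAdjunctionRight (ModuleCat.{u} k) c).unit.app _ ≫ (Limits.Sigma.ι P c).app c)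
          _ (Projective.π (F.obj c)) inferInstance ?_
        rw [Category.assoc]
        exact h
      exact NatTrans.epi_of_epi_app _
    have hP : ∀ c, Projective ((restriction k Φ).obj (P c)) := fun c =>
      E.projective_restriction_evaluationLeftAdjoint k c _
    have hS : Projective ((restriction k Φ).obj (∐ P)) :=
      Projective.of_iso (Limits.PreservesCoproduct.iso (restriction k Φ) P).symm (projective_sigma _)
    let r : Retract F (∐ P) :=
      ⟨Projective.factorThru (𝟙 F) (Limits.Sigma.desc q), Limits.Sigma.desc q,
        Projective.factorThru_comp _ _⟩
    exact (r.map (restriction k Φ)).projective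

include E in
theorem nonempty_tor_iso :
    Nonempty (Tor k (constFunctor k Dᵒᵖ) (Φ ⋙ F) ≅ Tor k (E.linearization k) F) :=
  have := E.preservesProjectiveObjects k
  DihHom.nonempty_tor_iso k (E.coendNatIso k) F

end ElementReflection

/-! ## Functor homology along an equivalence -/

section Equivalence

variable (k : Type u) [CommRing k] {C D : Type} [SmallCategory C] [SmallCategory D]

/-- The comparison map `E^*G ⊗_D E^*F ⟶ G ⊗_C F`. -/
noncomputable def coendRestrict (Φ : D ⥤ C) (G : Cᵒᵖ ⥤ ModuleCat.{u} k)
    (F : C ⥤ ModuleCat.{u} k) :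
    (tensorOver k (Φ.op ⋙ G)).obj (Φ ⋙ F) ⟶ (tensorOver k G).obj F :=
  coendLift (G := Φ.op ⋙ G) (F := Φ ⋙ F) (fun d => coendTmul G F (Φ.obj d))
    (fun x g y => coendTmul_map (Φ.map x) g y)

theorem coendRestrict_coendTmul (Φ : D ⥤ C) (G : Cᵒᵖ ⥤ ModuleCat.{u} k)
    (F : C ⥤ ModuleCat.{u} k) (d : D) (g : G.obj (Opposite.op (Φ.obj d)))
    (x : F.obj (Φ.obj d)) :
    coendRestrict k Φ G F (coendTmul (Φ.op ⋙ G) (Φ ⋙ F) d g x) = coendTmul G F (Φ.obj d) g x :=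
  coendLift_coendTmul (G := Φ.op ⋙ G) (F := Φ ⋙ F) _
    (fun x g y => coendTmul_map (Φ.map x) g y) _ _ _

/-- The inverse moves a tensor at $c$ to a chosen preimage of $c$, along an isomorphism `i c`. -/
instance isIso_coendRestrict (Φ : D ⥤ C) [Φ.IsEquivalence] (G : Cᵒᵖ ⥤ ModuleCat.{u} k)
    (F : C ⥤ ModuleCat.{u} k) : IsIso (coendRestrict k Φ G F) := by
  let i : ∀ c, Φ.obj (Φ.objPreimage c) ≅ c := Φ.objObjPreimageIso
  let β : ∀ c, G.obj (Opposite.op c) →ₗ[k] F.obj c →ₗ[k]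
      (tensorOver k (Φ.op ⋙ G)).obj (Φ ⋙ F) := fun c =>
    (coendTmul (Φ.op ⋙ G) (Φ ⋙ F) (Φ.objPreimage c)).compl₁₂
      (G.map (i c).hom.op).hom (F.map (i c).inv).hom
  -- When the target is in the image of $\Phi$, fullness lifts $f$ (precomposed with `i c`) to $D$,
  -- where the coend relation applies. The general target is reduced to this one by composing with
  -- `(i c').inv`.
  have hβ : ∀ {d : D} {c : C} (f : c ⟶ Φ.obj d) (g : G.obj (Opposite.op (Φ.obj d)))
      (x : F.obj c), β c (G.map f.op g) x =
        coendTmul (Φ.op ⋙ G) (Φ ⋙ F) d g (F.map f x) := by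
    intro d c f g x
    obtain ⟨y, hy⟩ := Φ.map_surjective ((i c).hom ≫ f)
    have h := coendTmul_map (G := Φ.op ⋙ G) (F := Φ ⋙ F) y g (F.map (i c).inv x)
    have h1 : (Φ.op ⋙ G).map y.op g = G.map (i c).hom.op (G.map f.op g) := by
      rw [← ConcreteCategory.comp_apply, ← G.map_comp, ← op_comp, ← hy]
      rfl
    have h2 : (Φ ⋙ F).map y (F.map (i c).inv x) = F.map f x := by
      rw [Functor.comp_map, ← ConcreteCategory.comp_apply, ← F.map_comp, hy,
        Iso.inv_hom_id_assoc]
    rw [h1, h2] at h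
    exact h
  have hβ' : ∀ {c c' : C} (f : c ⟶ c') (g : G.obj (Opposite.op c')) (x : F.obj c),
      β c (G.map f.op g) x = β c' g (F.map f x) := by
    intro c c' f g x
    have h := hβ (f ≫ (i c').inv) (G.map (i c').hom.op g) x
    have h1 : G.map (f ≫ (i c').inv).op (G.map (i c').hom.op g) = G.map f.op g := by
      rw [← ConcreteCategory.comp_apply, ← G.map_comp, ← op_comp, Category.assoc,
        Iso.inv_hom_id, Category.comp_id]
    rw [h1, F.map_comp] at h
    exact h
  refine ⟨coendLift β hβ', coend_hom_ext (F := Φ ⋙ F) fun d g x => ?_,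
    coend_hom_ext fun c g x => ?_⟩
  · refine (congrArg (coendLift β hβ') (coendRestrict_coendTmul k Φ G F d g x)).trans ?_
    rw [coendLift_coendTmul]
    have h := hβ (𝟙 (Φ.obj d)) g x
    rw [op_id, G.map_id, F.map_id] at h
    exact h
  · refine (congrArg (coendRestrict k Φ G F) (coendLift_coendTmul β hβ' c g x)).trans ?_
    refine (coendRestrict_coendTmul k Φ G F _ _ _).trans ?_
    refine (coendTmul_map (i c).hom g (F.map (i c).inv x)).trans ?_
    rw [← ConcreteCategory.comp_apply (F.map _), ← F.map_comp, Iso.inv_hom_id, F.map_id]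
    rfl

theorem nonempty_tor_iso_of_isEquivalence (Φ : D ⥤ C) [Φ.IsEquivalence]
    (G : Cᵒᵖ ⥤ ModuleCat.{u} k) (F : C ⥤ ModuleCat.{u} k) :
    Nonempty (Tor k (Φ.op ⋙ G) (Φ ⋙ F) ≅ Tor k G F) := by
  -- Restriction along an equivalence is itself an equivalence of functor categories.
  have : (restriction k Φ).PreservesProjectiveObjects :=
    ⟨fun {P} hP => (Φ.asEquivalence.symm.congrLeft (E := ModuleCat.{u} k)).map_projective_iff P |>.2
      hP⟩
  refine nonempty_tor_iso k (NatIso.ofComponents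
    (fun F => asIso (coendRestrict k Φ G F)) fun {F F'} η => ?_) F
  refine coend_hom_ext (F := Φ ⋙ F) fun d g x => ?_
  exact (congrArg (coendRestrict k Φ G F') (tensorOver_map_coendTmul (G := Φ.op ⋙ G)
      ((restriction k Φ).map η) d g x)).trans
    ((coendRestrict_coendTmul k Φ G F' d g (η.app _ x)).trans
    ((tensorOver_map_coendTmul (G := G) η (Φ.obj d) g x).symm.trans
      (congrArg _ (coendRestrict_coendTmul k Φ G F d g x).symm)))

end Equivalence

/-! ### Self-duality of the dihedral category -/

section Duality

variable {n m : ℕ}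

/-- The morphism of involutive non-commutative sets with given fibres. -/
noncomputable def IFHom.ofShuffle (F : Fin (m + 1) → List (Fin (n + 1) × ℤˣ))
    (hF : IsShuffle F) : IFHom n m where
  toFun j := (hF.2 j).choose
  fib := F
  nodup_fib := hF.1
  mem_fib _ j := ⟨fun h => (hF.2 j).unique (hF.2 j).choose_spec.1 h,
    fun h => h ▸ (hF.2 j).choose_spec.1⟩

/-- Concatenating the fibres of `(φ, g)` lists the elements of the source in the order of `g`. -/
theorem DHHom.flatMap_fib (x : DHHom n m) :
    (List.finRange (m + 1)).flatMap x.fib =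
      (List.finRange (n + 1)).map fun p => (x.grp.perm⁻¹ p, x.grp.lab (x.grp.perm⁻¹ p)) := by
  let r : Fin (n + 1) × ℤˣ → Fin (n + 1) × ℤˣ → Prop := fun a b =>
    x.grp.perm a.1 < x.grp.perm b.1
  have h1 : ((List.finRange (m + 1)).flatMap x.fib).Pairwise r := by
    rw [List.pairwise_flatMap]
    refine ⟨fun i _ => x.pairwise_fib i, (List.pairwise_lt_finRange _).imp ?_⟩
    intro i j hij a ha b hb
    rw [mem_fib_pair] at ha hb
    exact x.lt_of_toFun_lt (by rw [ha.1, hb.1]; exact hij)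
  have h2 : ((List.finRange (n + 1)).map fun p =>
      (x.grp.perm⁻¹ p, x.grp.lab (x.grp.perm⁻¹ p))).Pairwise r := by
    rw [List.pairwise_map]
    simp only [r, perm_apply_inv]
    exact List.pairwise_lt_finRange _
  have hnd : ∀ {L : List (Fin (n + 1) × ℤˣ)}, L.Pairwise r → L.Nodup := fun h =>
    h.imp fun hab e => absurd hab (by rw [e]; exact lt_irrefl _)
  refine List.Perm.eq_of_pairwise (fun a b _ _ hab hba => absurd hab (lt_asymm hba)) h1 h2 ?_
  rw [List.perm_ext_iff_of_nodup (hnd h1) (hnd h2)]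
  intro q
  simp only [List.mem_flatMap, List.mem_map, List.mem_finRange, true_and, mem_fib_pair]
  constructor
  · rintro ⟨i, -, h⟩
    exact ⟨x.grp.perm q.1, by simp [h]⟩
  · rintro ⟨p, rfl⟩
    exact ⟨_, rfl, rfl⟩

/-- The blocks of $\varphi$ are consecutive arcs which together go exactly once round the cycle
$[m]$, starting just after $\varphi(n)=\varphi(-1)$. -/
theorem flatMap_simpFam (φ : Fin (n + 1) →o Fin (m + 1)) :
    (List.finRange (n + 1)).flatMap (simpFam φ) =
      (walk (φ (-1)) (m + 1)).map fun j => (j, 1) := by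
  obtain ⟨r, h1, h2⟩ := walk_flatMap φ (-1) (n + 1)
  have h0 : (n + 1) • (1 : Fin (n + 1)) = 0 := by
    apply Fin.ext
    rw [val_nsmul_one, Nat.mod_self]
    rfl
  rw [h0, add_zero, Nat.add_div_right _ (Nat.succ_pos n), Nat.div_eq_of_lt (Fin.is_lt _)] at h2
  have hr : r = m + 1 := by omega
  unfold simpFam
  rw [← List.map_flatMap, finRange_eq_walk, h1, hr]

theorem perm_inv_apply {X : Type} (σ : Equiv.Perm X) (j : X) : σ⁻¹ (σ j) = j :=
  σ.symm_apply_apply j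

/-- The operator `φ^*` of the Loday functor is given by a morphism of `ΔD`. -/
theorem exists_dihedral_simpFam (φ : Fin (n + 1) →o Fin (m + 1)) :
    ∃ δ : DHHom m n, δ.grp ∈ Hyp.dihedral m ∧ δ.fib = simpFam φ := by
  obtain ⟨δ, hδ⟩ := DHHom.toIF_surjective (IFHom.ofShuffle (simpFam φ) (isShuffle_simpFam φ))
  have hfib : δ.fib = simpFam φ := congrArg IFHom.fib hδ
  refine ⟨δ, ?_, hfib⟩
  have h := δ.flatMap_fib
  rw [hfib, flatMap_simpFam, finRange_eq_walk] at h
  -- The concatenated fibres list $[m]$ in the order given by the group element. Here they form a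
  -- cyclic rotation of $0,\dots,m$ with trivial labels, so this order is that of a rotation.
  have hinv : ∀ p, δ.grp.perm⁻¹ p = φ (-1) + 1 + p ∧ δ.grp.lab (δ.grp.perm⁻¹ p) = 1 := by
    intro p
    have hp : (p : ℕ) • (1 : Fin (m + 1)) = p :=
      Fin.ext (by rw [val_nsmul_one, Nat.mod_eq_of_lt p.2])
    have h' := List.getElem_of_eq h (i := p) (by simpa [walk] using Nat.le_of_lt_succ p.2)
    simp only [walk, List.getElem_map, List.getElem_range, add_smul, one_smul, hp] at h'
    rw [neg_add_cancel_comm_assoc] at h'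
    have h1 := congrArg Prod.fst h'
    have h2 := congrArg Prod.snd h'
    refine ⟨h1.symm.trans ?_, h2.symm⟩
    dsimp only
    abel
  rw [mem_dihedral]
  -- The inverse of the rotation $p\mapsto\varphi(-1)+1+p$.
  refine ⟨1, -(φ (-1) + 1), Hyp.ext (funext fun j => ?_) (Equiv.ext fun j => ?_)⟩
  · have := (hinv (δ.grp.perm j)).2
    rwa [perm_inv_apply] at this
  · have := (hinv (δ.grp.perm j)).1
    rw [perm_inv_apply] at this
    rw [dihElt_perm, Units.val_one, one_smul]
    nth_rw 2 [this]
    abel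

/-- The fibres of an automorphism list its inverse permutation, so $g$ has to invert the indexing
that `dihFam` uses. -/
theorem exists_dihedral_dihFam {d : Hyp n} (hd : d ∈ Hyp.dihedral n) :
    ∃ g ∈ Hyp.dihedral n, (DHHom.ofGrp g).fib = dihFam d := by
  obtain ⟨ε, k, rfl⟩ := (mem_dihedral d).1 hd
  have key : ∀ (g : Hyp n) (hg : ∀ j, g.lab j = ε)
      (hp : ∀ i, g.perm ((dihElt ε k).perm (if ε = 1 then i else i - 1)) = i),
      (DHHom.ofGrp g).fib = dihFam (dihElt ε k) := by
    intro g hg hp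
    refine funext fun i => ((DHHom.ofGrp g).eq_fib i _ (fun q => ?_) ?_).symm
    · rw [dihFam_dihElt, List.mem_singleton]
      change _ ↔ g.perm q.1 = i ∧ g.lab q.1 = q.2
      rw [hg]
      constructor
      · rintro rfl
        exact ⟨hp i, rfl⟩
      · rintro ⟨h1, h2⟩
        refine Prod.ext (g.perm.injective ?_) h2.symm
        rw [h1, hp]
    · rw [dihFam_dihElt]
      exact List.pairwise_singleton _ _
  -- The rotation by $k$ is inverted by the rotation by $-k$. For a reflection, `dihFam` uses the
  -- index $i-1$, hence the map $i\mapsto k+1-i$, which is its own inverse.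
  rcases Int.units_eq_one_or ε with rfl | rfl
  · refine ⟨dihElt 1 (-k), (mem_dihedral _).2 ⟨_, _, rfl⟩, key _ (fun _ => rfl) fun i => ?_⟩
    simp
  · refine ⟨dihElt (-1) (k + 1), (mem_dihedral _).2 ⟨_, _, rfl⟩, key _ (fun _ => rfl) fun i => ?_⟩
    have h : ((-1 : ℤˣ) = 1) ↔ False := by decide
    simp only [h, if_false, dihElt_perm, Units.val_neg, Units.val_one, neg_smul, one_smul]
    abel

/-- The operators of the Loday functor are given by morphisms of `ΔD`. -/
theorem exists_dihedral_lodayFam {x : DHHom n m} (hx : x.grp ∈ Hyp.dihedral n) :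
    ∃ δ : DHHom m n, δ.grp ∈ Hyp.dihedral m ∧ δ.fib = lodayFam x := by
  obtain ⟨δ, hδ, h1⟩ := exists_dihedral_simpFam x.ord
  obtain ⟨g, hg, h2⟩ := exists_dihedral_dihFam hx
  refine ⟨δ.comp (DHHom.ofGrp g), mul_mem (pull_mem_dihedral hg _) hδ, ?_⟩
  have := congrArg IFHom.fib (DHHom.toIF_comp δ (DHHom.ofGrp g))
  refine this.trans ?_
  change famComp δ.fib (DHHom.ofGrp g).fib = _
  rw [h1, h2, lodayFam]

/-- The block of $0$ is the one that wraps around, from $\varphi(n)+1$ through $m$ and $0$ to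
$\varphi(0)$. -/
theorem zero_mem_simpFam (φ : Fin (n + 1) →o Fin (m + 1)) : (0, 1) ∈ simpFam φ 0 := by
  have h := blockLen_add φ 0
  rw [if_pos rfl] at h
  have hlt := (φ (0 - 1)).2
  simp only [simpFam, walk, List.map_map, List.mem_map, List.mem_range, Function.comp_apply]
  -- Index $i$ of `walk` is the successor number $i+1$, and $0$ is successor number $m+1-\varphi(n)$
  -- of $\varphi(n)$.
  refine ⟨m - φ (0 - 1), by omega, Prod.ext (Fin.ext ?_) rfl⟩
  have e : (φ (0 - 1) : ℕ) + (m - φ (0 - 1) + 1) = m + 1 := by omega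
  rw [val_add_nsmul_one, e, Nat.mod_self]
  rfl

/-- The block of $0$ is never empty and ends with $\varphi(0)$; the lengths of the other blocks are
the increments of $\varphi$. -/
theorem simpFam_injective :
    Function.Injective (simpFam : (Fin (n + 1) →o Fin (m + 1)) → _) := by
  intro φ φ' h
  have hlen : ∀ p, blockLen φ p = blockLen φ' p := fun p => by
    have := congrArg List.length (congrFun h p)
    simpa [simpFam, walk] using this
  have h0 : φ 0 = φ' 0 := by
    have hpos : ∀ ψ : Fin (n + 1) →o Fin (m + 1), ∃ s, blockLen ψ 0 = s + 1 := fun ψ => by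
      have h := blockLen_add ψ 0
      rw [if_pos rfl] at h
      have hlt := (ψ (0 - 1)).2
      exact ⟨blockLen ψ 0 - 1, by omega⟩
    have hlast : ∀ ψ : Fin (n + 1) →o Fin (m + 1),
        (simpFam ψ 0).getLast? = some (ψ 0, 1) := fun ψ => by
      obtain ⟨s, hs⟩ := hpos ψ
      rw [← add_blockLen ψ 0, simpFam, hs, walk_succ]
      simp
    have := hlast φ
    rw [h, hlast φ'] at this
    exact (congrArg Prod.fst (Option.some.inj this)).symm
  refine OrderHom.ext _ _ (funext fun p => ?_)
  induction p using Fin.induction with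
  | zero => exact h0
  | succ i ih =>
    have e : i.succ - 1 = i.castSucc := by
      rw [sub_eq_iff_eq_add]; exact (Fin.coeSucc_eq_succ).symm
    have h1 := add_blockLen φ i.succ
    have h2 := add_blockLen φ' i.succ
    rw [e] at h1 h2
    rw [← h1, ← h2, hlen, ih]

theorem dihFam_one : dihFam (1 : Hyp n) = famId _ := by
  funext i; simp [dihFam, famId]

/-- Locates the factor $a_0$: it lies in the block of $0$ whatever $\varphi$ is, so its position and
its label after applying $d$ depend on $d$ alone. This recovers $d$ from the family. -/
theorem exists_mem_lodayFam (φ : Fin (n + 1) →o Fin (m + 1)) (ε : ℤˣ) (k : Fin (n + 1)) :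
    ∃ p, (dihElt ε k).perm p = 0 ∧
      (0, ε) ∈ lodayFam ⟨φ, dihElt ε k⟩ (if ε = 1 then p else p + 1) := by
  refine ⟨(dihElt ε k).perm.symm 0, Equiv.apply_symm_apply _ _, ?_⟩
  have h0 := zero_mem_simpFam φ
  rcases Int.units_eq_one_or ε with rfl | rfl
  · simpa [lodayFam, famComp, dihFam_dihElt] using h0
  · have h : ((-1 : ℤˣ) = 1) ↔ False := by decide
    simp only [lodayFam, famComp, dihFam_dihElt, h, if_false, add_sub_cancel_right,
      Equiv.apply_symm_apply, List.flatMap_cons, List.flatMap_nil, List.append_nil, twist_neg_one,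
      List.mem_reverse, List.mem_map]
    exact ⟨_, h0, rfl⟩

/-- A morphism of `ΔD` is determined by its action on the Loday functor. -/
theorem lodayFam_injective {x y : DHHom n m} (hx : x.grp ∈ Hyp.dihedral n)
    (hy : y.grp ∈ Hyp.dihedral n) (h : lodayFam x = lodayFam y) : x = y := by
  have hgrp : x.grp = y.grp := by
    obtain ⟨φ, d⟩ := x
    obtain ⟨ψ, e⟩ := y
    obtain ⟨ε, k, rfl⟩ := (mem_dihedral d).1 hx
    obtain ⟨δ, j, rfl⟩ := (mem_dihedral e).1 hy
    obtain ⟨p, hp, hx0⟩ := exists_mem_lodayFam φ ε k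
    obtain ⟨q, hq, hy0⟩ := exists_mem_lodayFam ψ δ j
    rw [← h] at hy0
    have hs := isShuffle_lodayFam (x := ⟨φ, dihElt ε k⟩) hx
    -- The index $0$ occurs only once: its label gives $\varepsilon$, its position gives the
    -- preimage of $0$, and the two determine a dihedral element.
    have hi := (hs.2 0).unique (List.mem_map_of_mem hx0) (List.mem_map_of_mem hy0)
    rw [← hi] at hy0
    obtain rfl : ε = δ := congrArg Prod.snd (List.inj_on_of_nodup_map (hs.1 _) hx0 hy0 rfl)
    obtain rfl : p = q := by
      split_ifs at hi
      · exact hi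
      · exact add_right_cancel hi
    rw [dihElt_perm] at hp hq
    rw [add_right_cancel (hp.trans hq.symm)]
  -- Once the group parts agree they are cancelled, which leaves the families of the
  -- order-preserving parts.
  have hinv : famComp (dihFam x.grp) (dihFam x.grp⁻¹) = famId _ := by
    rw [← dihFam_mul hx (inv_mem hx), mul_inv_cancel, dihFam_one]
  refine DHHom.ext (simpFam_injective ?_) hgrp
  have h' := congrArg (fun F => famComp F (dihFam x.grp⁻¹)) h
  simp only [lodayFam, ← famComp_assoc, ← hgrp, hinv, famComp_famId] at h'
  exact h'

end Duality

/-! ### The functor $\Lambda\colon\Delta D^{op}\to\mathcal{IF}(as)$ and its reflection -/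

section LodayFunctor

variable {n m : ℕ}

instance : Finite (Hyp n) :=
  Finite.of_injective (fun g : Hyp n => (g.lab, g.perm)) fun _ _ h =>
    Hyp.ext (congrArg Prod.fst h) (congrArg Prod.snd h)

instance : Finite (DHHom n m) :=
  Finite.of_injective (fun x : DHHom n m => ((x.ord : Fin (n + 1) → Fin (m + 1)), x.grp))
    fun _ _ h => DHHom.ext (OrderHom.ext _ _ (congrArg Prod.fst h)) (congrArg Prod.snd h)

/-- The duality of the dihedral category on morphisms: `dual x` is the morphism of `ΔD` by which
`x` acts on the Loday functor. -/
noncomputable def dual (x : {x : DHHom n m // x.grp ∈ Hyp.dihedral n}) :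
    {δ : DHHom m n // δ.grp ∈ Hyp.dihedral m} :=
  ⟨(exists_dihedral_lodayFam x.2).choose, (exists_dihedral_lodayFam x.2).choose_spec.1⟩

theorem dual_fib (x : {x : DHHom n m // x.grp ∈ Hyp.dihedral n}) :
    (dual x).1.fib = lodayFam x.1 :=
  (exists_dihedral_lodayFam x.2).choose_spec.2

theorem dual_injective :
    Function.Injective (dual : {x : DHHom n m // x.grp ∈ Hyp.dihedral n} → _) := fun x y h =>
  Subtype.ext (lodayFam_injective x.2 y.2 (by rw [← dual_fib, h, dual_fib]))

/-- Counting: `dual` injects the dihedral morphisms $[n]\to[m]$ into those $[m]\to[n]$ and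
conversely, and both sets are finite. -/
theorem dual_surjective :
    Function.Surjective (dual : {x : DHHom n m // x.grp ∈ Hyp.dihedral n} → _) :=
  (dual_injective.bijective_of_nat_card_le
    (Nat.card_le_card_of_injective dual dual_injective)).2

/-- The functor `ΔDᵒᵖ ⥤ IF(as)` along which the Loday functor is the restriction of the
hyperoctahedral bar construction. -/
noncomputable def lodayFunctor : DeltaDᵒᵖ ⥤ IFas where
  obj a := ⟨a.unop.deg⟩
  map f := IFHom.ofShuffle (lodayFam f.unop.1) (isShuffle_lodayFam f.unop.2)
  map_id _ := IFHom.ext_fib lodayFam_id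
  map_comp f g := IFHom.ext_fib (lodayFam_comp g.unop.2 f.unop.2)

theorem lodayFunctor_map {a b : DeltaDᵒᵖ} (f : a ⟶ b) :
    lodayFunctor.map f = (dual f.unop).1.toIF :=
  IFHom.ext_fib (dual_fib f.unop).symm

theorem DHHom.ofGrp_inv_comp (g : Hyp n) :
    (DHHom.ofGrp g⁻¹).toIF.comp (DHHom.ofGrp g).toIF = IFHom.id n := by
  rw [← DHHom.toIF_comp, ← DHHom.toIF_id]
  congr 1
  exact (DHHom.ofGrp_comp _ _ _).trans (by rw [mul_inv_cancel]; rfl)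

theorem IFHom.id_comp (f : IFHom n m) : (IFHom.id n).comp f = f :=
  IFHom.ext_fib (famId_famComp f.fib)

theorem IFHom.comp_id (f : IFHom n m) : f.comp (IFHom.id m) = f :=
  IFHom.ext_fib (famComp_famId f.fib)

theorem DHHom.ofGrp_comp_left_injective (g : Hyp n) :
    Function.Injective ((DHHom.ofGrp g).toIF.comp : IFHom n m → IFHom n m) := fun x y h => by
  have h' := congrArg (DHHom.ofGrp g⁻¹).toIF.comp h
  simpa only [← IFHom.comp_assoc, DHHom.ofGrp_inv_comp, IFHom.id_comp] using h'

theorem IFHom.comp_ofGrp_one (f : IFHom n m) : f.comp (DHHom.ofGrp 1).toIF = f :=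
  (congrArg f.comp (DHHom.toIF_id m)).trans f.comp_id

theorem lodayFunctor_map_injective {a b : DeltaDᵒᵖ} {f g : a ⟶ b}
    (h : lodayFunctor.map f = lodayFunctor.map g) : f = g :=
  Quiver.Hom.unop_inj (Subtype.ext
    (lodayFam_injective f.unop.2 g.unop.2 (congrArg IFHom.fib h)))

/-- The hypothesis says that $f=\delta\circ h$ with $\delta$ in $\Delta D$, and by duality $\delta$
is $\Lambda$ of some $x$. Uniqueness holds because $h$ is invertible and $\Lambda$ is faithful. -/
theorem existsUnique_comp_lodayFunctor_map {c : IFas} (h : Hyp.plus c.deg) {d : DeltaDᵒᵖ}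
    (f : c ⟶ lodayFunctor.obj d) (hf : plusAct f 1 = h) :
    ∃! x : Opposite.op (DeltaD.mk c.deg) ⟶ d,
      IFHom.comp (DHHom.ofGrp h.1).toIF (lodayFunctor.map x) = f := by
  obtain ⟨δ, hδ, e⟩ := plusAct_spec f 1
  obtain ⟨x, hx⟩ := dual_surjective ⟨δ, hδ⟩
  let y : Opposite.op (DeltaD.mk c.deg) ⟶ d := Quiver.Hom.op (show d.unop ⟶ ⟨c.deg⟩ from x)
  have hy : IFHom.comp (DHHom.ofGrp h.1).toIF (lodayFunctor.map y) = f := by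
    have hmap : lodayFunctor.map y = δ.toIF :=
      (lodayFunctor_map y).trans (congrArg (fun z => DHHom.toIF z.1) hx)
    rw [hmap, ← hf]
    exact e.symm.trans (IFHom.comp_ofGrp_one f)
  exact ⟨y, hy, fun z hz => lodayFunctor_map_injective
    (DHHom.ofGrp_comp_left_injective h.1 (hz.trans hy.symm))⟩

/-- The elements of `H^+` are universally represented on `ΔDᵒᵖ`, by the unique factorization. -/
noncomputable def plusReflection : ElementReflection lodayFunctor where
  S c := Hyp.plus c.deg
  act f := plusAct f
  act_id := plusAct_id
  act_comp := plusAct_comp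
  base _ := 1
  -- A morphism in the image of $\Lambda$ lies in $\Delta D$, so its $H^+$-component is trivial.
  act_base x := plusAct_eq _ _ _ (dual x.unop).1 (dual x.unop).2 (by
    rw [lodayFunctor_map]
    exact (IFHom.comp_ofGrp_one _).trans
      ((congrArg (IFHom.comp · _) (DHHom.toIF_id _)).trans
        (IFHom.id_comp _)).symm)
  obj {c} _ := Opposite.op ⟨c.deg⟩
  unit h := (DHHom.ofGrp h.1).toIF
  act_unit {c} h := plusAct_eq _ _ _ (DHHom.id c.deg) (one_mem _) rfl
  existsUnique_desc h _ f hf := existsUnique_comp_lodayFunctor_map h f hf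

end LodayFunctor

/-! ### The equivalence $\Delta H\simeq\mathcal{IF}(as)$ -/

instance : deltaHToIF.Faithful where
  map_injective h := DHHom.toIF_injective h

instance : deltaHToIF.Full where
  map_surjective f := DHHom.toIF_surjective f

instance : deltaHToIF.EssSurj where
  mem_essImage c := ⟨⟨c.deg⟩, ⟨Iso.refl _⟩⟩

instance : deltaHToIF.IsEquivalence where

end DihHom

theorem corollary9p3 (k A : Type u) [CommRing k] [Ring A] [Algebra k A] [StarRing A]
    [DihHom.InvolutiveAlgebra k A] :
    Nonempty (DihHom.dihedralHomology k A ≅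
        DihHom.Tor k (DihHom.functorB k) (DihHom.hyperBar k A)) ∧
      Nonempty (DihHom.Tor k (DihHom.functorB k) (DihHom.hyperBar k A) ≅
        DihHom.Tor k (DihHom.functorBH k) (DihHom.hyperBarH k A)) :=
  -- By definition `loday k A` is `lodayFunctor ⋙ hyperBar k A`, and `functorB k` is the
  -- linearization of the presheaf in `plusReflection`; likewise `functorBH` and `hyperBarH` are
  -- restrictions along `deltaHToIF`. No transport is needed.
  ⟨DihHom.plusReflection.nonempty_tor_iso k (DihHom.hyperBar k A),
    (DihHom.nonempty_tor_iso_of_isEquivalence k DihHom.deltaHToIF (DihHom.functorB k)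
      (DihHom.hyperBar k A)).map Iso.symm⟩
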